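/- Let $n \ge 1$ and let $\alpha,\beta\in\mathbb C^n$ satisfy $\Re\alpha_j+\Re\beta_j>-1$ and $\alpha_j,\beta_j\notin\{-1,-2,-3,\dots\}$ for $1\le j\le n$. Let $\mathbb D$ be the open unit disc, $\mathbb T$ the unit circle in $\mathbb C$, and $m_n$ the normalized Haar measure on $\mathbb T^n$. For $f\in L^1(\mathbb T^n)$ (complex valued, with respect to $m_n$) put $$P_{\alpha,\beta}[f](z)=\int_{\mathbb T^n}\prod_{j=1}^n\left(\frac{\Gamma(\alpha_j+1)\Gamma(\beta_j+1)}{\Gamma(\alpha_j+\beta_j+1)}\cdot\frac{(1-|z_j|^2)^{\alpha_j+\beta_j+1}}{(1-z_j\overline{\zeta_j})^{\alpha_j+1}(1-\overline{z_j}\zeta_j)^{\beta_j+1}}\right) f(\zeta)\,dm_n(\zeta),\qquad z\in\mathbb D^n,$$ with principal branches of the powers. For $\eta\in\mathbb T^n$, $0<A<\infty$ and $1\le B<\infty$ let $S_{A,B}(\eta)$ be the set of all $z=(r_1\eta_1e^{-i\theta_1},\dots,r_n\eta_ne^{-i\theta_n})$ with $0\le r_j<1$ and $|\theta_j|\le A(1-r_j)$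 for all $j$, and $\max_{j,k}\frac{1-r_j}{1-r_k}\le B$. Then for every $f\in L^1(\mathbb T^n)$ the function $P_{\alpha,\beta}[f]$ has restricted non-tangential limit $f(\eta)$ at $m_n$-almost every $\eta\in\mathbb T^n$; that is, for almost every $\eta\in\mathbb T^n$, for all $0<A<\infty$ and $1\le B<\infty$, $$\lim_{z\to\eta,\ z\in S_{A,B}(\eta)}P_{\alpha,\beta}[f](z)=f(\eta).$$ -/

import Mathlib

open MeasureTheory Filter Topology

noncomputable section

namespace Polydisc

/-- The unit circle `𝕋 = {ζ ∈ ℂ : |ζ| = 1}` with its Borel σ-algebra. -/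
instance instMeasurableSpaceCircle : MeasurableSpace Circle := borel Circle

instance instBorelSpaceCircle : BorelSpace Circle := ⟨rfl⟩

/-- Normalized Haar measure on the torus `𝕋ⁿ`: the product of the Haar measures of total mass one
on the circles. -/
def torusMeasure (n : ℕ) : Measure (Fin n → Circle) :=
  Measure.pi fun _ => Measure.haarMeasure (⊤ : TopologicalSpace.PositiveCompacts Circle)

instance instIsProbabilityMeasureCircle :
    IsProbabilityMeasure
      (Measure.haarMeasure (⊤ : TopologicalSpace.PositiveCompacts Circle)) :=
  ⟨Measure.haarMeasure_self⟩

instance instIsProbabilityMeasureTorus (n : ℕ) : IsProbabilityMeasure (torusMeasure n) := by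
  unfold torusMeasure; infer_instance

instance instIsHaarMeasureTorus (n : ℕ) : (torusMeasure n).IsHaarMeasure := by
  unfold torusMeasure; infer_instance

/-- The point of `ℂⁿ` given by a point of the torus `𝕋ⁿ`. -/
def torusPoint {n : ℕ} (η : Fin n → Circle) : Fin n → ℂ := fun j => (η j : ℂ)

/-- `c_{a,b} = Γ(a+1) Γ(b+1) / Γ(a+b+1)`. -/
def poissonConst (a b : ℂ) : ℂ :=
  Complex.Gamma (a + 1) * Complex.Gamma (b + 1) / Complex.Gamma (a + b + 1)

/-- The `(α, β)`-Poisson kernel on `𝔻ⁿ × 𝕋ⁿ`. For `|z_j| < 1` the bases of the powers have positive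
real part, and the powers are the principal ones. -/
def abPoissonKernel {n : ℕ} (α β : Fin n → ℂ) (z : Fin n → ℂ) (ζ : Fin n → Circle) : ℂ :=
  ∏ j, poissonConst (α j) (β j) *
    (((1 - ‖z j‖ ^ 2 : ℝ) : ℂ) ^ (α j + β j + 1) /
      ((1 - z j * starRingEnd ℂ (ζ j : ℂ)) ^ (α j + 1) *
        (1 - starRingEnd ℂ (z j) * (ζ j : ℂ)) ^ (β j + 1)))

/-- The `(α, β)`-Poisson integral of a function on `𝕋ⁿ`; only its values at points of the polydisc
`𝔻ⁿ` are meaningful. -/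
def abPoissonIntegral {n : ℕ} (α β : Fin n → ℂ) (f : (Fin n → Circle) → ℂ) (z : Fin n → ℂ) : ℂ :=
  ∫ ζ, abPoissonKernel α β z ζ * f ζ ∂(torusMeasure n)

/-- The Stolz region `{ζ r e^{-iθ} : 0 ≤ r < 1, |θ| ≤ A (1 - r)}` of aperture `A` at `ζ ∈ 𝕋`. -/
def stolz (A : ℝ) (ζ : Circle) : Set ℂ :=
  {z | ∃ r θ : ℝ, 0 ≤ r ∧ r < 1 ∧ |θ| ≤ A * (1 - r) ∧
    z = r * ((ζ : ℂ) * Complex.exp (-(θ * Complex.I)))}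

/-- The restricted Stolz cone `S_{A,B}(η)`: points of the product of the Stolz regions at the `η_j`
for which all the ratios `(1 - |z_j|) / (1 - |z_k|)` are at most `B`. -/
def restrictedStolz {n : ℕ} (A B : ℝ) (η : Fin n → Circle) : Set (Fin n → ℂ) :=
  {z | (∀ j, z j ∈ stolz A (η j)) ∧ ∀ j k, (1 - ‖z j‖) / (1 - ‖z k‖) ≤ B}

/-- `u` has restricted non-tangential limit `l` at `η ∈ 𝕋ⁿ`: for every aperture `A > 0` and every
restriction `B ≥ 1`, `u z → l` as `z → η` within `S_{A,B}(η)`. -/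
def HasRNTLimit {n : ℕ} (u : (Fin n → ℂ) → ℂ) (η : Fin n → Circle) (l : ℂ) : Prop :=
  ∀ A B : ℝ, 0 < A → 1 ≤ B → Tendsto u (𝓝[restrictedStolz A B η] (torusPoint η)) (𝓝 l)

end Polydisc

end

noncomputable section

namespace Polydisc

open scoped ENNReal

/-! ### The binomial series and the growth of its coefficients -/

/-! The kernel is an approximate identity in the restricted cones, and a weak type estimate carries
convergence from continuous functions to `L¹`. Mass: expanding both powers in binomial series with
coefficients `p(c, k) = Ring.multichoose c k`, the integral of one factor is `c_{a,b} (1 -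
x)^(a+b+1) ∑ p(a+1, k) p(b+1, k) x^k` with `x = |z|²`. As `p(c, k) ~ k^(c-1) / Γ(c)`, the constant
`c_{a,b}` makes the coefficients agree with `p(a+b+1, k)` to leading order, and an Abelian argument
gives the limit `1` (`tendsto_integral_kernelFactor`). Size: in a restricted cone all `1 - |z_j|`
are comparable to one scale `h`, so the kernel is at most a constant times a product of profiles
`h^s / (h + dist)^(s+1)` (`exists_norm_abPoissonKernel_le`). Maximal estimate: the strong maximal
function is not of weak type on `L¹`. Instead the majorant is cut into boxes with sides `2^(k_j) h`.
For fixed `k` these form a one-parameter family, so Vitali covering gives a weak `(1,1)` bound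
uniform in `k`. Half of the decay `2^(-s k_j)` pays for summing the exceptional sets over `k`, the
other half for summing the pieces of the integral (`exists_measure_exceptionalSet_le`,
`exists_lintegral_majorant_le`). Borel–Cantelli with continuous approximants concludes. -/

theorem hasSum_multichoose (c w : ℂ) (hw : ‖w‖ < 1) :
    HasSum (fun k : ℕ => Ring.multichoose c k * w ^ k) ((1 - w) ^ c)⁻¹ := by
  have h := (Complex.one_div_one_sub_cpow_hasFPowerSeriesOnBall_zero c).hasSum
    (y := w) (by simpa [enorm_eq_nnnorm, ← NNReal.coe_lt_one] using hw)
  simpa [FormalMultilinearSeries.ofScalars_apply_eq, Ring.multichoose_eq, mul_comm] using h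

theorem multichoose_eq_prod_div (c : ℂ) (k : ℕ) :
    Ring.multichoose c k = (∏ j ∈ Finset.range k, (c + j)) / (k.factorial : ℂ) := by
  have h := Ring.factorial_nsmul_multichoose_eq_ascPochhammer c k
  have hk : (k.factorial : ℂ) ≠ 0 := by exact_mod_cast k.factorial_ne_zero
  rw [eq_div_iff hk, mul_comm, ← nsmul_eq_mul, h, Polynomial.ascPochhammer_smeval_eq_eval]
  clear h hk
  induction k with
  | zero => simp
  | succ k ih => rw [ascPochhammer_succ_eval, ih, Finset.prod_range_succ]

/-- The product in `GammaSeq c k` has `k + 1` factors, one more than the rising factorial in `p(c,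
k)`; the factor `c + k` compensates. -/
theorem GammaSeq_mul_multichoose (c : ℂ) (hc : ∀ k : ℕ, c ≠ -(k : ℂ)) (k : ℕ) :
    Ring.multichoose c k * Complex.GammaSeq c k * (c + k) = (k : ℂ) ^ c := by
  have hk : (k.factorial : ℂ) ≠ 0 := by exact_mod_cast k.factorial_ne_zero
  have hj (j : ℕ) : c + j ≠ 0 := fun h => hc j (eq_neg_of_add_eq_zero_left h)
  have hp : ∏ j ∈ Finset.range k, (c + j) ≠ 0 := Finset.prod_ne_zero_iff.2 fun j _ => hj j
  rw [multichoose_eq_prod_div, Complex.GammaSeq, Finset.prod_range_succ]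
  have := hj k
  field_simp

/-- `p(c, k) ~ k ^ (c - 1) / Γ(c)`. -/
theorem tendsto_multichoose (c : ℂ) (hc : ∀ k : ℕ, c ≠ -(k : ℂ)) :
    Tendsto (fun k : ℕ => Ring.multichoose c k * (k : ℂ) ^ (1 - c)) atTop
      (𝓝 (Complex.Gamma c)⁻¹) := by
  have hΓ : Complex.Gamma c ≠ 0 := Complex.Gamma_ne_zero hc
  have h1 : Tendsto (fun k : ℕ => (k : ℂ) / (c + k)) atTop (𝓝 1) := by
    have h := tendsto_natCast_div_add_atTop (𝕜 := ℂ) c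
    simpa [add_comm] using h
  have h2 := (Complex.GammaSeq_tendsto_Gamma c).inv₀ hΓ
  have h3 := h2.mul h1
  rw [mul_one] at h3
  refine h3.congr' ?_
  filter_upwards [eventually_gt_atTop 0, (Complex.GammaSeq_tendsto_Gamma c).eventually_ne hΓ]
    with k hk hG
  have hk' : (k : ℂ) ≠ 0 := by exact_mod_cast hk.ne'
  have hj : c + k ≠ 0 := fun h => hc k (eq_neg_of_add_eq_zero_left h)
  have h := GammaSeq_mul_multichoose c hc k
  have e : (k : ℂ) ^ c * (k : ℂ) ^ (1 - c) = k := by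
    rw [← Complex.cpow_add _ _ hk']; simp
  have : Ring.multichoose c k = (k : ℂ) ^ c / (Complex.GammaSeq c k * (c + k)) := by
    rw [eq_div_iff (mul_ne_zero hG hj), ← h]; ring
  rw [this, div_mul_eq_mul_div, e]
  field_simp

theorem multichoose_ofReal (σ : ℝ) (k : ℕ) :
    Ring.multichoose (σ : ℂ) k = ((Ring.multichoose σ k : ℝ) : ℂ) :=
  (Ring.map_multichoose (algebraMap ℝ ℂ) σ k).symm

theorem multichoose_pos {σ : ℝ} (hσ : 0 < σ) (k : ℕ) : 0 < Ring.multichoose σ k := by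
  have h := Ring.factorial_nsmul_multichoose_eq_ascPochhammer σ k
  rw [Polynomial.ascPochhammer_smeval_eq_eval, nsmul_eq_mul] at h
  have h2 := ascPochhammer_pos k σ hσ
  rw [← h] at h2
  exact pos_of_mul_pos_right h2 (by positivity)

theorem hasSum_multichoose_real (σ x : ℝ) (h0 : 0 ≤ x) (h1 : x < 1) :
    HasSum (fun k : ℕ => Ring.multichoose σ k * x ^ k) ((1 - x) ^ σ)⁻¹ := by
  have h := hasSum_multichoose σ x (by rwa [Complex.norm_real, Real.norm_of_nonneg h0])
  rw [← Complex.hasSum_ofReal]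
  convert h using 1
  · ext k; push_cast [multichoose_ofReal]; rfl
  · rw [Complex.ofReal_inv, Complex.ofReal_cpow (by linarith)]; push_cast; rfl

/-- An Abelian theorem: coefficients `o(p(σ, k))` give a function `o((1 - x) ^ (-σ))`. -/
theorem tendsto_rpow_mul_tsum_zero {σ : ℝ} (hσ : 0 < σ) (d : ℕ → ℂ)
    (hd : Tendsto (fun k => d k / (Ring.multichoose σ k : ℝ)) atTop (𝓝 0)) :
    Tendsto (fun x : ℝ => (1 - x) ^ σ * ‖∑' k, d k * (x : ℂ) ^ k‖) (𝓝[<] 1) (𝓝 0) := by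
  have hb (ε : ℝ) (hε : 0 < ε) : ∃ N, ∀ k, N ≤ k → ‖d k‖ ≤ ε * Ring.multichoose σ k := by
    obtain ⟨N, hN⟩ := (Metric.tendsto_atTop.1 hd) ε hε
    refine ⟨N, fun k hk => ?_⟩
    have h := hN k hk
    rw [dist_zero_right, norm_div, Complex.norm_real,
      Real.norm_of_nonneg (multichoose_pos hσ k).le, div_lt_iff₀ (multichoose_pos hσ k)] at h
    exact h.le
  rw [Metric.tendsto_nhdsWithin_nhds]
  intro ε hε
  obtain ⟨N, hN⟩ := hb (ε / 2) (by positivity)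
  -- The head contributes at most `M`, which `(1 - x)^σ` kills; the tail is at most `ε / 2` times
  -- the series of `(1 - x)^(-σ)`.
  set M := ∑ k ∈ Finset.range N, ‖d k‖ with hM
  have hM0 : 0 ≤ M := Finset.sum_nonneg fun _ _ => norm_nonneg _
  have hlim : Tendsto (fun x : ℝ => (1 - x) ^ σ * M) (𝓝 1) (𝓝 0) := by
    have : ContinuousAt (fun x : ℝ => (1 - x) ^ σ * M) 1 :=
      ((continuousAt_const.sub continuousAt_id).rpow_const (Or.inr hσ.le)).mul continuousAt_const
    simpa [ContinuousAt, Real.zero_rpow hσ.ne'] using this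
  obtain ⟨δ, hδ, hδ'⟩ := Metric.tendsto_nhds_nhds.1 hlim (ε / 2) (by positivity)
  refine ⟨min δ 1, by positivity, fun {x} hx1 hxd => ?_⟩
  have hx1 : x < 1 := hx1
  have hx0 : 0 < x := by
    have := hxd.trans_le (min_le_right _ _)
    rw [Real.dist_eq, abs_lt] at this; linarith
  have hxδ := hδ' (hxd.trans_le (min_le_left _ _))
  have hpow : 0 < (1 - x) ^ σ := Real.rpow_pos_of_pos (by linarith) _
  rw [dist_zero_right, Real.norm_of_nonneg (by positivity)] at hxδ ⊢
  have hS := (hasSum_multichoose_real σ x hx0.le hx1)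
  have hS2 := hS.mul_left (ε / 2)
  have hfin : HasSum (fun k => if k ∈ Finset.range N then ‖d k‖ else 0) M := by
    rw [hM]
    have : HasSum (fun k => if k ∈ Finset.range N then ‖d k‖ else 0)
        (∑ k ∈ Finset.range N, if k ∈ Finset.range N then ‖d k‖ else 0) :=
      hasSum_sum_of_ne_finset_zero (fun b hb => by simp [hb])
    convert this using 1
    exact Finset.sum_congr rfl fun k hk => by simp [hk]
  have hle (k : ℕ) : ‖d k * (x : ℂ) ^ k‖ ≤ (if k ∈ Finset.range N then ‖d k‖ else 0) +
      ε / 2 * (Ring.multichoose σ k * x ^ k) := by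
    rw [norm_mul, norm_pow, Complex.norm_real, Real.norm_of_nonneg hx0.le]
    have hp := multichoose_pos hσ k
    have hxk : x ^ k ≤ 1 := pow_le_one₀ hx0.le hx1.le
    have hxk0 : 0 < x ^ k := by positivity
    split_ifs with h
    · have : ‖d k‖ * x ^ k ≤ ‖d k‖ := mul_le_of_le_one_right (norm_nonneg _) hxk
      have : 0 ≤ ε / 2 * (Ring.multichoose σ k * x ^ k) := by positivity
      linarith
    · rw [Finset.mem_range, not_lt] at h
      calc ‖d k‖ * x ^ k ≤ (ε / 2 * Ring.multichoose σ k) * x ^ k := by gcongr; exact hN k h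
        _ = _ := by ring
  have hnorm := tsum_of_norm_bounded (hfin.add hS2) hle
  calc (1 - x) ^ σ * ‖∑' k, d k * (x : ℂ) ^ k‖
      ≤ (1 - x) ^ σ * (M + ε / 2 * ((1 - x) ^ σ)⁻¹) := by gcongr
    _ = (1 - x) ^ σ * M + ε / 2 := by field_simp
    _ < ε := by linarith

theorem cpow_ofReal_one_sub_norm (x : ℝ) (hx : x < 1) (w : ℂ) :
    ‖((1 - x : ℝ) : ℂ) ^ w‖ = (1 - x) ^ w.re :=
  Complex.norm_cpow_eq_rpow_re_of_pos (by linarith) w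

/-- Both terms of the numerator are asymptotic to `k^(a+b) / Γ(a+b+1)`, by the choice of
`poissonConst`; the denominator has order `k^(Re a + Re b)`. -/
theorem tendsto_coeff_ratio (a b : ℂ) (hab : -1 < a.re + b.re)
    (ha : ∀ k : ℕ, a + 1 ≠ -(k : ℂ)) (hb : ∀ k : ℕ, b + 1 ≠ -(k : ℂ)) :
    Tendsto (fun k : ℕ => (poissonConst a b * (Ring.multichoose (a + 1) k *
      Ring.multichoose (b + 1) k) - Ring.multichoose (a + b + 1) k) /
        (Ring.multichoose (a.re + b.re + 1) k : ℝ)) atTop (𝓝 0) := by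
  set σ := a.re + b.re + 1 with hσ
  have hσ0 : 0 < σ := by linarith
  have hne (c : ℂ) (hc : 0 < c.re) (k : ℕ) : c ≠ -(k : ℂ) := by
    intro h
    rw [h] at hc
    simp at hc
    linarith [(Nat.cast_nonneg k : (0 : ℝ) ≤ k)]
  have hc := hne (a + b + 1) (by simpa using hσ0)
  have h1 := tendsto_multichoose _ ha
  have h2 := tendsto_multichoose _ hb
  have h3 := tendsto_multichoose _ hc
  have h4 := tendsto_multichoose (σ : ℂ) (hne _ (by simpa using hσ0))
  have hG1 := Complex.Gamma_ne_zero ha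
  have hG2 := Complex.Gamma_ne_zero hb
  have hG3 := Complex.Gamma_ne_zero hc
  have hG4 := Complex.Gamma_ne_zero (hne (σ : ℂ) (by simpa using hσ0))
  have hnum := ((h1.mul h2).const_mul (poissonConst a b)).sub h3
  have hlim : poissonConst a b * ((Complex.Gamma (a + 1))⁻¹ * (Complex.Gamma (b + 1))⁻¹) -
      (Complex.Gamma (a + b + 1))⁻¹ = 0 := by
    rw [poissonConst]; field_simp; simp
  rw [hlim] at hnum
  -- The powers of `k` with exponents `1 - (a+b+1)` and `1 - σ` differ by a unimodular factor, so
  -- they cancel only after taking norms.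
  have hq := (hnum.div h4 (inv_ne_zero hG4)).norm
  rw [tendsto_zero_iff_norm_tendsto_zero]
  simp only [zero_div, norm_zero] at hq
  refine hq.congr' ?_
  filter_upwards [eventually_gt_atTop 0] with k hk
  have hk' : (k : ℂ) ≠ 0 := by exact_mod_cast hk.ne'
  have hkr : (0 : ℝ) < k := by exact_mod_cast hk
  have e : (k : ℂ) ^ (1 - (a + 1)) * (k : ℂ) ^ (1 - (b + 1)) = (k : ℂ) ^ (1 - (a + b + 1)) := by
    rw [← Complex.cpow_add _ _ hk']; congr 1; ring
  have e2 : poissonConst a b * (Ring.multichoose (a + 1) k * (k : ℂ) ^ (1 - (a + 1)) *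
      (Ring.multichoose (b + 1) k * (k : ℂ) ^ (1 - (b + 1)))) -
      Ring.multichoose (a + b + 1) k * (k : ℂ) ^ (1 - (a + b + 1)) =
      (poissonConst a b * (Ring.multichoose (a + 1) k * Ring.multichoose (b + 1) k) -
        Ring.multichoose (a + b + 1) k) * (k : ℂ) ^ (1 - (a + b + 1)) := by
    rw [← e]; ring
  rw [Pi.div_apply, e2, multichoose_ofReal, norm_div, norm_mul, norm_mul, norm_div,
    Complex.norm_natCast_cpow_of_pos hk, Complex.norm_natCast_cpow_of_pos hk]
  have : (1 - (a + b + 1)).re = (1 - (σ : ℂ)).re := by simp [hσ]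
  rw [this]
  have : (k : ℝ) ^ (1 - (σ : ℂ)).re ≠ 0 := (Real.rpow_pos_of_pos hkr _).ne'
  field_simp

theorem summable_coeff (a b : ℂ) (x : ℝ) (h0 : 0 ≤ x) (h1 : x < 1) :
    Summable fun k : ℕ =>
      Ring.multichoose (a + 1) k * Ring.multichoose (b + 1) k * (x : ℂ) ^ k := by
  -- With `x^k = y^k y^k`, one series converges absolutely at `y` and the terms of the other are
  -- bounded.
  set y := √x
  have hy : y < 1 := by rw [Real.sqrt_lt' one_pos]; simpa
  have hy0 : 0 ≤ y := Real.sqrt_nonneg x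
  have hyn : ‖(y : ℂ)‖ < 1 := by rwa [Complex.norm_real, Real.norm_of_nonneg hy0]
  have hA := (hasSum_multichoose (a + 1) y hyn).summable.norm
  have hB := (hasSum_multichoose (b + 1) y hyn).summable.norm
  have hBb := hB.tendsto_atTop_zero.bddAbove_range
  obtain ⟨C, hC⟩ := hBb
  refine Summable.of_norm_bounded (hA.mul_right C) fun k => ?_
  have e : (x : ℂ) = y * y := by
    rw [← Complex.ofReal_mul, Real.mul_self_sqrt h0]
  rw [e, mul_pow, show ∀ p q r : ℂ, p * q * (r * r) = (p * r) * (q * r) by intros; ring, norm_mul]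
  gcongr
  exact hC ⟨k, rfl⟩

/-- The asymptotic form of Euler's transformation and Gauss's summation formula. -/
theorem tendsto_cpow_mul_tsum (a b : ℂ) (hab : -1 < a.re + b.re)
    (ha : ∀ k : ℕ, a + 1 ≠ -(k : ℂ)) (hb : ∀ k : ℕ, b + 1 ≠ -(k : ℂ)) :
    Tendsto (fun x : ℝ => poissonConst a b * (((1 - x : ℝ) : ℂ) ^ (a + b + 1) *
      ∑' k, Ring.multichoose (a + 1) k * Ring.multichoose (b + 1) k * (x : ℂ) ^ k))
      (𝓝[<] 1) (𝓝 1) := by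
  have hσ0 : 0 < a.re + b.re + 1 := by linarith
  -- The comparison series `∑ p(a+b+1, k) x^k` is exactly the inverse of the prefactor, so this
  -- quantity is the distance to `1`.
  have h := tendsto_rpow_mul_tsum_zero hσ0 _ (tendsto_coeff_ratio a b hab ha hb)
  rw [tendsto_iff_norm_sub_tendsto_zero]
  refine h.congr' ?_
  filter_upwards [self_mem_nhdsWithin, mem_nhdsWithin_of_mem_nhds (lt_mem_nhds zero_lt_one)]
    with x hx1 hx0
  have hx1 : x < 1 := hx1
  have hS := hasSum_multichoose (a + b + 1) x
    (by rwa [Complex.norm_real, Real.norm_of_nonneg hx0.le])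
  have hT := (summable_coeff a b x hx0.le hx1).hasSum.mul_left (poissonConst a b)
  have hD := hT.sub hS
  have e : (fun k : ℕ => (poissonConst a b * (Ring.multichoose (a + 1) k *
      Ring.multichoose (b + 1) k) - Ring.multichoose (a + b + 1) k) * (x : ℂ) ^ k) =
      fun k => poissonConst a b * (Ring.multichoose (a + 1) k *
      Ring.multichoose (b + 1) k * (x : ℂ) ^ k) - Ring.multichoose (a + b + 1) k * (x : ℂ) ^ k := by
    ext k; ring
  rw [e, hD.tsum_eq]
  have hr : a.re + b.re + 1 = (a + b + 1).re := by simp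
  rw [hr, ← cpow_ofReal_one_sub_norm x hx1, ← norm_mul]
  congr 1
  have hne : ((1 - x : ℝ) : ℂ) ^ (a + b + 1) ≠ 0 := by
    rw [Complex.cpow_ne_zero_iff]
    exact Or.inl (by exact_mod_cast (by linarith : (1 - x) ≠ 0))
  have e2 : (1 - (x : ℂ)) = ((1 - x : ℝ) : ℂ) := by push_cast; rfl
  rw [e2]
  field_simp

/-! ### Integrals over the circle -/

/-- The normalized Haar measure of the circle. -/
abbrev circleMeasure : Measure Circle :=
  Measure.haarMeasure (⊤ : TopologicalSpace.PositiveCompacts Circle)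

theorem integral_circle_zpow (n : ℤ) :
    ∫ ζ : Circle, (ζ : ℂ) ^ n ∂circleMeasure = if n = 0 then 1 else 0 := by
  split_ifs with hn
  · simp [hn]
  -- Rotation by `g`, where `g^n = -1`, changes the sign of the integral.
  · set g : Circle := Circle.exp (Real.pi / n)
    have hg : (g : ℂ) ^ n = -1 := by
      rw [← Circle.coe_zpow, ← Circle.exp_intCast_mul, mul_div_cancel₀ _ (by exact_mod_cast hn),
        Circle.coe_exp, Complex.exp_pi_mul_I]
    have h := integral_mul_left_eq_self (μ := circleMeasure) (fun ζ : Circle => (ζ : ℂ) ^ n) g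
    simp only [Circle.coe_mul, mul_zpow, hg, integral_const_mul] at h
    linear_combination (-1 / 2) * h

/-- The one-dimensional factor of the kernel. -/
def kernelFactor (a b z : ℂ) (ζ : Circle) : ℂ :=
  poissonConst a b * (((1 - ‖z‖ ^ 2 : ℝ) : ℂ) ^ (a + b + 1) /
    ((1 - z * starRingEnd ℂ (ζ : ℂ)) ^ (a + 1) * (1 - starRingEnd ℂ z * (ζ : ℂ)) ^ (b + 1)))

theorem abPoissonKernel_eq_prod {n : ℕ} (α β z : Fin n → ℂ) (ζ : Fin n → Circle) :
    abPoissonKernel α β z ζ = ∏ j, kernelFactor (α j) (β j) (z j) (ζ j) := rfl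

theorem one_sub_mem_slitPlane {w : ℂ} (hw : ‖w‖ < 1) : 1 - w ∈ Complex.slitPlane := by
  refine Complex.mem_slitPlane_iff.2 (Or.inl ?_)
  have := Complex.re_le_norm w
  simp only [Complex.sub_re, Complex.one_re]
  linarith

theorem continuous_kernelFactor (a b z : ℂ) (hz : ‖z‖ < 1) : Continuous (kernelFactor a b z) := by
  have h1 (ζ : Circle) : 1 - z * starRingEnd ℂ (ζ : ℂ) ∈ Complex.slitPlane :=
    one_sub_mem_slitPlane (by simpa [Circle.norm_coe] using hz)
  have h2 (ζ : Circle) : 1 - starRingEnd ℂ z * (ζ : ℂ) ∈ Complex.slitPlane :=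
    one_sub_mem_slitPlane (by simpa [Circle.norm_coe] using hz)
  have hc : Continuous fun ζ : Circle => starRingEnd ℂ (ζ : ℂ) :=
    Complex.continuous_conj.comp continuous_subtype_val
  have c1 : Continuous fun ζ : Circle => (1 - z * starRingEnd ℂ (ζ : ℂ)) ^ (a + 1) :=
    (continuous_const.sub (continuous_const.mul hc)).cpow continuous_const h1
  have c2 : Continuous fun ζ : Circle => (1 - starRingEnd ℂ z * (ζ : ℂ)) ^ (b + 1) :=
    (continuous_const.sub (continuous_const.mul continuous_subtype_val)).cpow continuous_const h2
  refine continuous_const.mul (continuous_const.div (c1.mul c2) fun ζ => mul_ne_zero ?_ ?_)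
  · exact (Complex.cpow_ne_zero_iff).2 (Or.inl (Complex.slitPlane_ne_zero (h1 ζ)))
  · exact (Complex.cpow_ne_zero_iff).2 (Or.inl (Complex.slitPlane_ne_zero (h2 ζ)))

/-- Parseval: the norms of the terms of the double series are constant on the circle and summable,
and orthogonality leaves only the diagonal. -/
theorem integral_inv_cpow_mul_inv_cpow (c d z : ℂ) (hz : ‖z‖ < 1) :
    ∫ ζ : Circle, ((1 - z * starRingEnd ℂ (ζ : ℂ)) ^ c)⁻¹ *
      ((1 - starRingEnd ℂ z * (ζ : ℂ)) ^ d)⁻¹ ∂circleMeasure =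
    ∑' k, Ring.multichoose c k * Ring.multichoose d k * ((‖z‖ ^ 2 : ℝ) : ℂ) ^ k := by
  set F : ℕ × ℕ → Circle → ℂ := fun p ζ =>
    (Ring.multichoose c p.1 * (z * starRingEnd ℂ (ζ : ℂ)) ^ p.1) *
      (Ring.multichoose d p.2 * (starRingEnd ℂ z * (ζ : ℂ)) ^ p.2) with hF
  have hcont (p : ℕ × ℕ) : Continuous (F p) := by
    have hc : Continuous fun ζ : Circle => starRingEnd ℂ (ζ : ℂ) :=
      Complex.continuous_conj.comp continuous_subtype_val
    have hc' : Continuous fun ζ : Circle => (ζ : ℂ) := continuous_subtype_val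
    simp only [hF]
    fun_prop
  have hint (p : ℕ × ℕ) : Integrable (F p) circleMeasure :=
    (hcont p).integrable_of_hasCompactSupport (HasCompactSupport.of_compactSpace _)
  have hA := (hasSum_multichoose c z hz).summable.norm
  have hB := (hasSum_multichoose d z hz).summable.norm
  have hnorm (p : ℕ × ℕ) (ζ : Circle) : ‖F p ζ‖ =
      ‖Ring.multichoose c p.1 * z ^ p.1‖ * ‖Ring.multichoose d p.2 * z ^ p.2‖ := by
    simp [hF, Circle.norm_coe]
  have hsum : Summable fun p => ∫ ζ, ‖F p ζ‖ ∂circleMeasure := by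
    simp only [hnorm, integral_const, probReal_univ, one_smul]
    exact hA.mul_of_nonneg hB (fun _ => norm_nonneg _) (fun _ => norm_nonneg _)
  have h := hasSum_integral_of_summable_integral_norm hint hsum
  have hpt (ζ : Circle) : ∑' p, F p ζ = ((1 - z * starRingEnd ℂ (ζ : ℂ)) ^ c)⁻¹ *
      ((1 - starRingEnd ℂ z * (ζ : ℂ)) ^ d)⁻¹ := by
    have h1 := hasSum_multichoose c (z * starRingEnd ℂ (ζ : ℂ))
      (by simpa [Circle.norm_coe] using hz)
    have h2 := hasSum_multichoose d (starRingEnd ℂ z * (ζ : ℂ))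
      (by simpa [Circle.norm_coe] using hz)
    rw [← h1.tsum_eq, ← h2.tsum_eq,
      tsum_mul_tsum_of_summable_norm h1.summable.norm h2.summable.norm]
  simp only [hpt] at h
  have hval (p : ℕ × ℕ) : ∫ ζ, F p ζ ∂circleMeasure = Ring.multichoose c p.1 *
      Ring.multichoose d p.2 * (z ^ p.1 * starRingEnd ℂ z ^ p.2) *
        (if (p.2 : ℤ) - p.1 = 0 then 1 else 0) := by
    rw [← integral_circle_zpow, ← integral_const_mul]
    congr 1
    ext ζ
    simp only [hF, ← Circle.coe_inv_eq_conj, Circle.coe_inv, mul_pow, inv_pow,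
      zpow_sub₀ (Circle.coe_ne_zero ζ), zpow_natCast]
    field_simp
  rw [← h.tsum_eq]
  have hinj : Function.Injective fun k : ℕ => (k, k) := fun k l hkl => (Prod.ext_iff.1 hkl).1
  rw [← hinj.tsum_eq (f := fun p => ∫ ζ, F p ζ ∂circleMeasure)]
  · congr 1
    ext k
    have : ((‖z‖ ^ 2 : ℝ) : ℂ) = z * starRingEnd ℂ z := by
      rw [Complex.mul_conj, Complex.normSq_eq_norm_sq]
    rw [hval, this, mul_pow]
    simp
  · intro p hp
    by_contra hcon
    refine hp ?_
    have hp' : p.2 ≠ p.1 := by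
      intro he
      exact hcon ⟨p.1, Prod.ext rfl he.symm⟩
    show ∫ ζ, F p ζ ∂circleMeasure = 0
    rw [hval, if_neg (by rw [sub_eq_zero]; exact_mod_cast hp'), mul_zero]

theorem integral_kernelFactor (a b z : ℂ) (hz : ‖z‖ < 1) :
    ∫ ζ, kernelFactor a b z ζ ∂circleMeasure =
      poissonConst a b * (((1 - ‖z‖ ^ 2 : ℝ) : ℂ) ^ (a + b + 1) *
        ∑' k, Ring.multichoose (a + 1) k * Ring.multichoose (b + 1) k *
          ((‖z‖ ^ 2 : ℝ) : ℂ) ^ k) := by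
  rw [← integral_inv_cpow_mul_inv_cpow _ _ z hz, ← integral_const_mul, ← integral_const_mul]
  congr 1
  ext ζ
  rw [kernelFactor, div_eq_mul_inv, mul_inv]

/-- The kernel is asymptotically normalized at the boundary. -/
theorem tendsto_integral_kernelFactor (a b : ℂ) (hab : -1 < a.re + b.re)
    (ha : ∀ k : ℕ, 1 ≤ k → a ≠ -(k : ℂ)) (hb : ∀ k : ℕ, 1 ≤ k → b ≠ -(k : ℂ))
    {ι : Type*} {l : Filter ι} {z : ι → ℂ} (hz : ∀ᶠ i in l, ‖z i‖ < 1)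
    (hlim : Tendsto (fun i => ‖z i‖) l (𝓝 1)) :
    Tendsto (fun i => ∫ ζ, kernelFactor a b (z i) ζ ∂circleMeasure) l (𝓝 1) := by
  have aux (c : ℂ) (hc : ∀ k : ℕ, 1 ≤ k → c ≠ -(k : ℂ)) (k : ℕ) : c + 1 ≠ -(k : ℂ) := by
    intro h
    refine hc (k + 1) (by omega) ?_
    push_cast
    linear_combination h
  have hl : Tendsto (fun i => ‖z i‖ ^ 2) l (𝓝[<] 1) := by
    refine tendsto_nhdsWithin_iff.2 ⟨by simpa using hlim.pow 2, ?_⟩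
    filter_upwards [hz] with i hi
    exact pow_lt_one₀ (norm_nonneg _) hi two_ne_zero
  refine ((tendsto_cpow_mul_tsum a b hab (aux a ha) (aux b hb)).comp hl).congr' ?_
  filter_upwards [hz] with i hi
  rw [integral_kernelFactor a b _ hi, Function.comp_apply]

/-! ### The measure of an arc -/

theorem dist_circle (x y : Circle) : dist x y = ‖(x : ℂ) - y‖ := dist_eq_norm (x : ℂ) y

theorem dist_exp_exp (x y : ℝ) :
    dist (Circle.exp x) (Circle.exp y) = 2 * |Real.sin ((x - y) / 2)| := by
  have h := Complex.norm_exp_I_mul_ofReal_sub_one (x - y)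
  rw [norm_mul, Real.norm_eq_abs, Real.norm_eq_abs, abs_two] at h
  rw [dist_circle, ← h, Circle.coe_exp, Circle.coe_exp]
  have : Complex.exp (x * Complex.I) - Complex.exp (y * Complex.I) =
      Complex.exp (y * Complex.I) * (Complex.exp (Complex.I * ((x - y : ℝ) : ℂ)) - 1) := by
    rw [mul_sub, ← Complex.exp_add, mul_one]
    congr 2
    push_cast; ring
  rw [this, norm_mul, Complex.norm_exp_ofReal_mul_I, one_mul]

theorem dist_circle_mul_left (g x y : Circle) : dist (g * x) (g * y) = dist x y := by
  rw [dist_circle, dist_circle, Circle.coe_mul, Circle.coe_mul,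
    ← mul_sub, norm_mul, Circle.norm_coe, one_mul]

theorem circleMeasure_ball_mul (g x : Circle) (ρ : ℝ) :
    circleMeasure (Metric.ball (g * x) ρ) = circleMeasure (Metric.ball x ρ) := by
  rw [← measure_preimage_mul circleMeasure g (Metric.ball (g * x) ρ)]
  congr 1
  ext y
  simp [dist_circle_mul_left]

/-- Packing: the `N` points at angles `π i / N` are at mutual distance at least `2 / N`, so `N`
disjoint balls of equal measure fit into total mass one. Staying on a half circle keeps half the
angle differences in `[0, π/2]`, where `sin t ≥ 2t/π`. -/
theorem circleMeasure_ball_inv_natCast (x : Circle) (N : ℕ) (hN : 0 < N) :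
    circleMeasure (Metric.ball x (1 / N)) ≤ (N : ENNReal)⁻¹ := by
  have hN' : (0 : ℝ) < N := by exact_mod_cast hN
  set c : Fin N → Circle := fun i => Circle.exp (Real.pi * i / N) with hc
  have key (i j : Fin N) (hij : i < j) : 2 / N ≤ dist (c i) (c j) := by
    rw [dist_comm, dist_exp_exp]
    have hij' : ((i : ℕ) : ℝ) + 1 ≤ (j : ℕ) := by exact_mod_cast hij
    have hjN : ((j : ℕ) : ℝ) ≤ N := by exact_mod_cast j.2.le
    have hi0 : (0 : ℝ) ≤ (i : ℕ) := Nat.cast_nonneg _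
    have hpi := Real.pi_pos
    have e : (Real.pi * (j : ℕ) / N - Real.pi * (i : ℕ) / N) / 2 =
        Real.pi / 2 * (((j : ℕ) - (i : ℕ)) / N) := by field_simp
    have h1 : 1 / N ≤ (((j : ℕ) : ℝ) - (i : ℕ)) / N := by gcongr; linarith
    have h2 : (((j : ℕ) : ℝ) - (i : ℕ)) / N ≤ 1 := by rw [div_le_one hN']; linarith
    have h0 : 0 ≤ (((j : ℕ) : ℝ) - (i : ℕ)) / N := le_trans (by positivity) h1
    have hs := Real.mul_le_sin (x := Real.pi / 2 * (((j : ℕ) - (i : ℕ)) / N)) (by positivity)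
      (mul_le_of_le_one_right (by positivity) h2)
    have e2 : 2 / Real.pi * (Real.pi / 2 * ((((j : ℕ) : ℝ) - (i : ℕ)) / N)) =
      (((j : ℕ) : ℝ) - (i : ℕ)) / N := by field_simp
    rw [e2] at hs
    rw [e]
    calc (2 : ℝ) / N = 2 * (1 / N) := by ring
      _ ≤ 2 * |_| := by gcongr; exact (h1.trans hs).trans (le_abs_self _)
  have hdisj : Pairwise (Function.onFun Disjoint fun i => Metric.ball (c i) (1 / N)) := by
    intro i j hij
    refine Metric.ball_disjoint_ball ?_
    have e : (1 : ℝ) / N + 1 / N = 2 / N := by ring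
    rw [e]
    rcases lt_or_gt_of_ne hij with h | h
    · exact key i j h
    · rw [dist_comm]; exact key j i h
  have hm := measure_iUnion (μ := circleMeasure) hdisj (fun i => Metric.isOpen_ball.measurableSet)
  have hball (i : Fin N) : circleMeasure (Metric.ball (c i) (1 / N)) =
      circleMeasure (Metric.ball x (1 / N)) := by
    have := circleMeasure_ball_mul (c i * x⁻¹) x (1 / N)
    rwa [inv_mul_cancel_right] at this
  simp only [hball, tsum_fintype, Finset.sum_const, Finset.card_univ, Fintype.card_fin,
    nsmul_eq_mul] at hm
  have hle : (N : ENNReal) * circleMeasure (Metric.ball x (1 / N)) ≤ 1 := hm ▸ prob_le_one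
  rw [ENNReal.le_inv_iff_mul_le, mul_comm]
  exact hle

theorem circleMeasure_ball_le (x : Circle) (ρ : ℝ) :
    circleMeasure (Metric.ball x ρ) ≤ ENNReal.ofReal (2 * ρ) := by
  rcases le_or_gt ρ 0 with h0 | h0
  · simp [Metric.ball_eq_empty.2 h0]
  rcases lt_or_ge 1 ρ with h1 | h1
  · refine prob_le_one.trans ?_
    rw [← ENNReal.ofReal_one]
    exact ENNReal.ofReal_le_ofReal (by linarith)
  -- Then `ρ ≤ 1 / N`, and `1 / ρ < N + 1 ≤ 2 N` gives `1 / N ≤ 2 ρ`.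
  set N := ⌊1 / ρ⌋₊
  have h1ρ : 1 ≤ 1 / ρ := by rwa [le_div_iff₀ h0, one_mul]
  have hN : 0 < N := Nat.floor_pos.2 h1ρ
  have hN1 : (1 : ℝ) ≤ N := by exact_mod_cast hN
  have hle : (N : ℝ) ≤ 1 / ρ := Nat.floor_le (by positivity)
  have hlt : 1 / ρ < N + 1 := Nat.lt_floor_add_one _
  have hN0 : (0 : ℝ) < N := by linarith
  calc circleMeasure (Metric.ball x ρ) ≤ circleMeasure (Metric.ball x (1 / N)) := by
        refine measure_mono (Metric.ball_subset_ball ?_)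
        rw [le_div_iff₀ hN0]
        rw [le_div_iff₀ h0] at hle
        linarith
    _ ≤ (N : ENNReal)⁻¹ := circleMeasure_ball_inv_natCast x N hN
    _ = ENNReal.ofReal ((N : ℝ)⁻¹) := by
        rw [ENNReal.ofReal_inv_of_pos hN0, ENNReal.ofReal_natCast]
    _ ≤ ENNReal.ofReal (2 * ρ) := by
        refine ENNReal.ofReal_le_ofReal ?_
        rw [inv_le_iff_one_le_mul₀ hN0]
        rw [div_lt_iff₀ h0] at hlt
        nlinarith

/-! ### Maximal functions over boxes of fixed eccentricity -/

/-- The product of the arcs of radius `ρ j` about `η j`. -/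
def box {n : ℕ} (η : Fin n → Circle) (ρ : Fin n → ℝ) : Set (Fin n → Circle) :=
  Set.univ.pi fun j => Metric.ball (η j) (ρ j)

theorem isOpen_box {n : ℕ} (η : Fin n → Circle) (ρ : Fin n → ℝ) : IsOpen (box η ρ) :=
  isOpen_set_pi Set.finite_univ fun _ _ => Metric.isOpen_ball

theorem mem_box_self {n : ℕ} (η : Fin n → Circle) {ρ : Fin n → ℝ} (hρ : ∀ j, 0 < ρ j) :
    η ∈ box η ρ := fun j _ => Metric.mem_ball_self (hρ j)

theorem torusMeasure_box_le {n : ℕ} (η : Fin n → Circle) (ρ : Fin n → ℝ) :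
    torusMeasure n (box η ρ) ≤ ∏ j, ENNReal.ofReal (2 * ρ j) := by
  rw [torusMeasure, box, Measure.pi_pi]
  exact Finset.prod_le_prod' fun j _ => circleMeasure_ball_le _ _

/-- The set where the maximal function of `g` over the boxes with sides `w j * h`, `0 < h ≤ 1`,
exceeds `lam`. -/
def boxLevelSet {n : ℕ} (g : (Fin n → Circle) → ℝ≥0∞) (w : Fin n → ℝ) (lam : ℝ≥0∞) :
    Set (Fin n → Circle) :=
  {η | ∃ h : ℝ, 0 < h ∧ h ≤ 1 ∧ lam * ∏ j, ENNReal.ofReal (w j * h) <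
    ∫⁻ ζ in box η (fun j => w j * h), g ζ ∂(torusMeasure n)}

/-- The weak type `(1, 1)` inequality, with a constant that does not depend on the
eccentricity. -/
theorem mul_measure_boxLevelSet_le {n : ℕ} (g : (Fin n → Circle) → ℝ≥0∞) (w : Fin n → ℝ)
    (hw : ∀ j, 0 < w j) (lam : ℝ≥0∞) :
    lam * torusMeasure n (boxLevelSet g w lam) ≤ 6 ^ n * ∫⁻ ζ, g ζ ∂(torusMeasure n) := by
  set B : (Fin n → Circle) × ℝ → Set (Fin n → Circle) := fun p => box p.1 fun j => w j * p.2
  set t : Set ((Fin n → Circle) × ℝ) := {p | 0 < p.2 ∧ p.2 ≤ 1 ∧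
    lam * ∏ j, ENNReal.ofReal (w j * p.2) < ∫⁻ ζ in B p, g ζ ∂(torusMeasure n)}
  have hne : ∀ p ∈ t, (B p).Nonempty := fun p hp =>
    ⟨p.1, mem_box_self _ fun j => mul_pos (hw j) hp.1⟩
  -- The boxes are ordered by the single parameter `h`. Only centres need covering, so a selected
  -- box with parameter at least `h / 2` has to be enlarged by `1 + 2 = 3` only.
  obtain ⟨u, hut, hdisj, hu⟩ := Vitali.exists_disjoint_subfamily_covering_enlargement B t
    (fun p => p.2) 2 one_lt_two (fun p hp => hp.1.le) 1 (fun p hp => hp.2.1) hne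
  have hcount : u.Countable := hdisj.countable_of_isOpen (fun p _ => isOpen_box _ _)
    fun p hp => hne p (hut hp)
  have hcover : boxLevelSet g w lam ⊆ ⋃ p ∈ u, box p.1 fun j => 3 * (w j * p.2) := by
    rintro η ⟨h, h0, h1, hlt⟩
    obtain ⟨p, hp, ⟨ζ, hζ1, hζ2⟩, hle⟩ := hu (η, h) ⟨h0, h1, hlt⟩
    refine Set.mem_biUnion hp fun j _ => ?_
    have d1 : dist (ζ j) (η j) < w j * h := hζ1 j trivial
    have d2 : dist (ζ j) (p.1 j) < w j * p.2 := hζ2 j trivial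
    have d3 : w j * h ≤ w j * (2 * p.2) := mul_le_mul_of_nonneg_left hle (hw j).le
    have := dist_triangle_left (η j) (p.1 j) (ζ j)
    rw [Metric.mem_ball]
    linarith
  have hbox (p : (Fin n → Circle) × ℝ) (hp : p ∈ u) :
      lam * torusMeasure n (box p.1 fun j => 3 * (w j * p.2)) ≤
        6 ^ n * ∫⁻ ζ in B p, g ζ ∂(torusMeasure n) := by
    -- The constant `6` is `3` from the enlargement times `2` from the arc estimate.
    have e : ∏ j, ENNReal.ofReal (2 * (3 * (w j * p.2))) =
        6 ^ n * ∏ j, ENNReal.ofReal (w j * p.2) := by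
      have (j : Fin n) : ENNReal.ofReal (2 * (3 * (w j * p.2))) =
          6 * ENNReal.ofReal (w j * p.2) := by
        rw [← mul_assoc, ENNReal.ofReal_mul (by norm_num)]
        norm_num
      simp [this, Finset.prod_mul_distrib]
    calc lam * torusMeasure n (box p.1 fun j => 3 * (w j * p.2))
        ≤ lam * (6 ^ n * ∏ j, ENNReal.ofReal (w j * p.2)) := by
          rw [← e]; gcongr; exact torusMeasure_box_le _ _
      _ = 6 ^ n * (lam * ∏ j, ENNReal.ofReal (w j * p.2)) := by ring
      _ ≤ _ := by gcongr; exact (hut hp).2.2.le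
  calc lam * torusMeasure n (boxLevelSet g w lam)
      ≤ lam * ∑' p : u, torusMeasure n (box p.1.1 fun j => 3 * (w j * p.1.2)) := by
        gcongr
        exact (measure_mono hcover).trans (measure_biUnion_le _ hcount _)
    _ = ∑' p : u, lam * torusMeasure n (box p.1.1 fun j => 3 * (w j * p.1.2)) :=
        ENNReal.tsum_mul_left.symm
    _ ≤ ∑' p : u, 6 ^ n * ∫⁻ ζ in B p, g ζ ∂(torusMeasure n) :=
        ENNReal.tsum_le_tsum fun p => hbox p p.2
    _ = 6 ^ n * ∫⁻ ζ in ⋃ p ∈ u, B p, g ζ ∂(torusMeasure n) := by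
        rw [ENNReal.tsum_mul_left,
          lintegral_biUnion hcount (fun p _ => (isOpen_box _ _).measurableSet) hdisj]
    _ ≤ 6 ^ n * ∫⁻ ζ, g ζ ∂(torusMeasure n) := by
        gcongr
        exact Measure.restrict_le_self

theorem tsum_prod_eq_pow (n : ℕ) (a : ℕ → ℝ≥0∞) :
    ∑' k : Fin n → ℕ, ∏ j, a (k j) = (∑' m, a m) ^ n := by
  induction n with
  | zero => simp
  | succ n ih =>
    rw [← (Fin.consEquiv fun _ : Fin (n + 1) => ℕ).tsum_eq, ENNReal.tsum_prod', pow_succ', ← ih,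
      ← ENNReal.tsum_mul_right]
    refine tsum_congr fun m => ?_
    rw [← ENNReal.tsum_mul_left]
    refine tsum_congr fun k => ?_
    rw [Fin.prod_univ_succ]
    simp [Fin.consEquiv]

theorem tsum_ofReal_geometric_ne_top (c q : ℝ) (h0 : 0 ≤ q) (h1 : q < 1) :
    ∑' m : ℕ, ENNReal.ofReal (c * q ^ m) ≠ ∞ :=
  ((summable_geometric_of_lt_one h0 h1).mul_left c).tsum_ofReal_ne_top

/-- The exceptional set for the majorant of exponent `s`: a union of level sets of the maximal
functions of all dyadic eccentricities `2 ^ k`, at levels growing geometrically in `k`. -/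
def exceptionalSet {n : ℕ} (s : ℝ) (g : (Fin n → Circle) → ℝ≥0∞) (lam : ℝ≥0∞) :
    Set (Fin n → Circle) :=
  ⋃ k : Fin n → ℕ, boxLevelSet g (fun j => 2 ^ k j)
    (lam * ∏ j, ENNReal.ofReal (((2 : ℝ) ^ (s / 2)) ^ k j))

/-- At level `lam * ∏ r^(k_j)`, with `r = 2^(s/2)`, the weak type bound gains `∏ r^(-k_j)`; the sum
over `k` is a product of `n` geometric series. -/
theorem exists_measure_exceptionalSet_le (n : ℕ) {s : ℝ} (hs : 0 < s) :
    ∃ C : ℝ≥0∞, C ≠ ∞ ∧ ∀ (g : (Fin n → Circle) → ℝ≥0∞) (lam : ℝ≥0∞),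
      lam * torusMeasure n (exceptionalSet s g lam) ≤ C * ∫⁻ ζ, g ζ ∂(torusMeasure n) := by
  set r : ℝ := (2 : ℝ) ^ (s / 2) with hr
  have hr0 : 0 < r := by positivity
  have hr1 : 1 < r := Real.one_lt_rpow one_lt_two (by positivity)
  have hr' : r⁻¹ < 1 := inv_lt_one_of_one_lt₀ hr1
  refine ⟨6 ^ n * (∑' m : ℕ, ENNReal.ofReal (1 * r⁻¹ ^ m)) ^ n,
    ENNReal.mul_ne_top (by finiteness) (ENNReal.pow_ne_top
      (tsum_ofReal_geometric_ne_top 1 _ (by positivity) hr')), fun g lam => ?_⟩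
  set I := ∫⁻ ζ, g ζ ∂(torusMeasure n)
  have hk (k : Fin n → ℕ) : lam * torusMeasure n (boxLevelSet g (fun j => 2 ^ k j)
      (lam * ∏ j, ENNReal.ofReal (r ^ k j))) ≤
      6 ^ n * I * ∏ j, ENNReal.ofReal (1 * r⁻¹ ^ k j) := by
    have h := mul_measure_boxLevelSet_le g (fun j => 2 ^ k j) (fun j => by positivity)
      (lam * ∏ j, ENNReal.ofReal (r ^ k j))
    have e : (∏ j, ENNReal.ofReal (r ^ k j)) * ∏ j, ENNReal.ofReal (1 * r⁻¹ ^ k j) = 1 := by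
      rw [← Finset.prod_mul_distrib]
      refine Finset.prod_eq_one fun j _ => ?_
      rw [← ENNReal.ofReal_mul (by positivity), one_mul, ← mul_pow, mul_inv_cancel₀ hr0.ne']
      simp
    set M := torusMeasure n (boxLevelSet g (fun j => 2 ^ k j)
      (lam * ∏ j, ENNReal.ofReal (r ^ k j)))
    calc lam * M = lam * M * 1 := (mul_one _).symm
      _ = (lam * ∏ j, ENNReal.ofReal (r ^ k j)) * M *
          ∏ j, ENNReal.ofReal (1 * r⁻¹ ^ k j) := by rw [← e]; ring
      _ ≤ _ := by gcongr
  calc lam * torusMeasure n (exceptionalSet s g lam)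
      ≤ lam * ∑' k : Fin n → ℕ, torusMeasure n (boxLevelSet g (fun j => 2 ^ k j)
          (lam * ∏ j, ENNReal.ofReal (r ^ k j))) := by
        gcongr; exact measure_iUnion_le _
    _ ≤ ∑' k : Fin n → ℕ, 6 ^ n * I * ∏ j, ENNReal.ofReal (1 * r⁻¹ ^ k j) := by
        rw [← ENNReal.tsum_mul_left]; exact ENNReal.tsum_le_tsum hk
    _ = _ := by
        rw [ENNReal.tsum_mul_left, tsum_prod_eq_pow n fun m => ENNReal.ofReal (1 * r⁻¹ ^ m)]
        ring

/-! ### The majorant of the kernel -/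

/-- A product of dilates at a common scale `h` of a power-decay profile. -/
def majorant {n : ℕ} (s h : ℝ) (η ζ : Fin n → Circle) : ℝ :=
  ∏ j, h ^ s / (h + dist (ζ j) (η j)) ^ (s + 1)

theorem majorant_nonneg {n : ℕ} (s : ℝ) {h : ℝ} (hh : 0 < h) (η ζ : Fin n → Circle) :
    0 ≤ majorant s h η ζ := Finset.prod_nonneg fun j _ => by positivity

theorem exists_dyadic_bound {s h t : ℝ} (hs : 0 < s) (hh : 0 < h) (ht : 0 ≤ t) :
    ∃ k : ℕ, t < 2 ^ k * h ∧
      h ^ s / (h + t) ^ (s + 1) ≤ 2 ^ (s + 1) * ((2 : ℝ) ^ (-s)) ^ k * (2 ^ k * h)⁻¹ := by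
  have hex : ∃ k : ℕ, t < 2 ^ k * h := by
    obtain ⟨k, hk⟩ := pow_unbounded_of_one_lt (t / h) (one_lt_two : (1 : ℝ) < 2)
    exact ⟨k, by rwa [div_lt_iff₀ hh] at hk⟩
  classical
  -- Minimality of `k` gives the reverse comparison `2^k h / 2 ≤ h + t`.
  refine ⟨Nat.find hex, Nat.find_spec hex, ?_⟩
  set k := Nat.find hex with hk
  have hlow : 2 ^ k * h / 2 ≤ h + t := by
    rcases Nat.eq_zero_or_pos k with h0 | h0
    · rw [h0]; linarith
    · have := Nat.find_min hex (m := k - 1) (by omega)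
      have e : (2 : ℝ) ^ k = 2 ^ (k - 1) * 2 := by rw [← pow_succ, Nat.sub_add_cancel h0]
      rw [e]
      linarith
  have hy : 0 < 2 ^ k * h := by positivity
  have e1 : h ^ s = (2 ^ k * h) ^ s * ((2 : ℝ) ^ (-s)) ^ k := by
    rw [Real.mul_rpow (by positivity) hh.le, Real.rpow_neg two_pos.le, inv_pow,
      ← Real.rpow_natCast, ← Real.rpow_natCast, ← Real.rpow_mul two_pos.le,
      ← Real.rpow_mul two_pos.le, mul_comm s]
    have : (2 : ℝ) ^ ((k : ℝ) * s) ≠ 0 := by positivity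
    field_simp
  calc h ^ s / (h + t) ^ (s + 1) ≤ h ^ s / (2 ^ k * h / 2) ^ (s + 1) := by gcongr
    _ = _ := by
      rw [Real.div_rpow hy.le two_pos.le, e1, Real.rpow_add_one hy.ne']
      have : (2 ^ k * h) ^ s ≠ 0 := by positivity
      field_simp

theorem ofReal_majorant_le_tsum {n : ℕ} {s h : ℝ} (hs : 0 < s) (hh : 0 < h)
    (η ζ : Fin n → Circle) :
    ENNReal.ofReal (majorant s h η ζ) ≤ ∑' k : Fin n → ℕ,
      (box η fun j => 2 ^ k j * h).indicator
        (fun _ => ∏ j, ENNReal.ofReal (2 ^ (s + 1) * ((2 : ℝ) ^ (-s)) ^ k j * (2 ^ k j * h)⁻¹))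
        ζ := by
  choose k hk1 hk2 using fun j => exists_dyadic_bound hs hh (dist_nonneg (x := ζ j) (y := η j))
  refine le_trans ?_ (ENNReal.le_tsum k)
  rw [Set.indicator_of_mem (show ζ ∈ box η fun j => 2 ^ k j * h from fun j _ => hk1 j), majorant,
    ENNReal.ofReal_prod_of_nonneg fun j _ => by positivity]
  exact Finset.prod_le_prod' fun j _ => ENNReal.ofReal_le_ofReal (hk2 j)

/-- Off the exceptional set, the integrals against the majorants are controlled at all scales. -/
theorem exists_lintegral_majorant_le (n : ℕ) {s : ℝ} (hs : 0 < s) :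
    ∃ C : ℝ≥0∞, C ≠ ∞ ∧ ∀ (g : (Fin n → Circle) → ℝ≥0∞) (lam : ℝ≥0∞),
      AEMeasurable g (torusMeasure n) → ∀ η ∉ exceptionalSet s g lam, ∀ h : ℝ, 0 < h → h ≤ 1 →
        ∫⁻ ζ, ENNReal.ofReal (majorant s h η ζ) * g ζ ∂(torusMeasure n) ≤ C * lam := by
  -- `q = 2^(-s) 2^(s/2)`: decay of the majorant against growth of the levels. The box sides cancel.
  set q : ℝ := (2 : ℝ) ^ (-(s / 2)) with hq
  have hq1 : q < 1 := Real.rpow_lt_one_of_one_lt_of_neg one_lt_two (by linarith)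
  refine ⟨(∑' m : ℕ, ENNReal.ofReal (2 ^ (s + 1) * q ^ m)) ^ n, ENNReal.pow_ne_top
    (tsum_ofReal_geometric_ne_top _ _ (by positivity) hq1), ?_⟩
  intro g lam hg η hη h h0 h1
  set c : (Fin n → ℕ) → ℝ≥0∞ := fun k =>
    ∏ j, ENNReal.ofReal (2 ^ (s + 1) * ((2 : ℝ) ^ (-s)) ^ k j * (2 ^ k j * h)⁻¹) with hc
  have hbox (k : Fin n → ℕ) : ∫⁻ ζ in box η (fun j => 2 ^ k j * h), g ζ ∂(torusMeasure n) ≤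
      lam * (∏ j, ENNReal.ofReal (((2 : ℝ) ^ (s / 2)) ^ k j)) *
        ∏ j, ENNReal.ofReal (2 ^ k j * h) := by
    by_contra hcon
    exact hη (Set.mem_iUnion.2 ⟨k, h, h0, h1, not_le.1 hcon⟩)
  have hind (k : Fin n → ℕ) (ζ : Fin n → Circle) :
      (box η fun j => 2 ^ k j * h).indicator (fun _ => c k) ζ * g ζ =
        c k * (box η fun j => 2 ^ k j * h).indicator g ζ := by
    by_cases hζ : ζ ∈ box η fun j => 2 ^ k j * h <;> simp [hζ]
  calc ∫⁻ ζ, ENNReal.ofReal (majorant s h η ζ) * g ζ ∂(torusMeasure n)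
      ≤ ∫⁻ ζ, ∑' k : Fin n → ℕ, c k * (box η fun j => 2 ^ k j * h).indicator g ζ
          ∂(torusMeasure n) := by
        refine lintegral_mono fun ζ => ?_
        simp only [← hind, ENNReal.tsum_mul_right]
        gcongr
        exact ofReal_majorant_le_tsum hs h0 η ζ
    _ = ∑' k : Fin n → ℕ, c k * ∫⁻ ζ in box η (fun j => 2 ^ k j * h), g ζ ∂(torusMeasure n) := by
        rw [lintegral_tsum fun k =>
          (hg.indicator (isOpen_box _ _).measurableSet).const_mul _]
        refine tsum_congr fun k => ?_
        rw [lintegral_const_mul'' _ (hg.indicator (isOpen_box _ _).measurableSet),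
          lintegral_indicator (isOpen_box _ _).measurableSet]
    _ ≤ ∑' k : Fin n → ℕ, lam * ∏ j, ENNReal.ofReal (2 ^ (s + 1) * q ^ k j) := by
        refine ENNReal.tsum_le_tsum fun k => ?_
        calc c k * ∫⁻ ζ in box η (fun j => 2 ^ k j * h), g ζ ∂(torusMeasure n)
            ≤ c k * (lam * (∏ j, ENNReal.ofReal (((2 : ℝ) ^ (s / 2)) ^ k j)) *
              ∏ j, ENNReal.ofReal (2 ^ k j * h)) := by gcongr; exact hbox k
          _ = lam * (c k * (∏ j, ENNReal.ofReal (((2 : ℝ) ^ (s / 2)) ^ k j)) *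
              ∏ j, ENNReal.ofReal (2 ^ k j * h)) := by ring
          _ = _ := by
            rw [hc, ← Finset.prod_mul_distrib, ← Finset.prod_mul_distrib]
            congr 1
            refine Finset.prod_congr rfl fun j _ => ?_
            rw [← ENNReal.ofReal_mul (by positivity), ← ENNReal.ofReal_mul (by positivity)]
            congr 1
            have e : q = (2 : ℝ) ^ (-s) * (2 : ℝ) ^ (s / 2) := by
              rw [← Real.rpow_add two_pos, hq]; congr 1; ring
            have : (2 : ℝ) ^ k j * h ≠ 0 := by positivity
            rw [e, mul_pow]
            field_simp
    _ = _ := by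
        rw [ENNReal.tsum_mul_left,
          tsum_prod_eq_pow n fun m => ENNReal.ofReal (2 ^ (s + 1) * q ^ m), mul_comm]

/-- The maximal bound for `g = 1`: a box has measure at most `2^n` times the product of its radii,
so no point is exceptional at level `2^n`. -/
theorem exists_lintegral_majorant_le_const (n : ℕ) {s : ℝ} (hs : 0 < s) :
    ∃ C : ℝ≥0∞, C ≠ ∞ ∧ ∀ (η : Fin n → Circle) (h : ℝ), 0 < h → h ≤ 1 →
      ∫⁻ ζ, ENNReal.ofReal (majorant s h η ζ) ∂(torusMeasure n) ≤ C := by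
  obtain ⟨C, hC, H⟩ := exists_lintegral_majorant_le n hs
  refine ⟨C * 2 ^ n, ENNReal.mul_ne_top hC (by finiteness), fun η h h0 h1 => ?_⟩
  have hη : η ∉ exceptionalSet s (fun _ => 1) (2 ^ n : ℝ≥0∞) := by
    rw [exceptionalSet, Set.mem_iUnion]
    rintro ⟨k, h, h0, h1, hlt⟩
    refine absurd hlt (not_lt.2 ?_)
    rw [lintegral_one, Measure.restrict_apply_univ]
    have hr : 1 ≤ ∏ j, ENNReal.ofReal (((2 : ℝ) ^ (s / 2)) ^ k j) := by
      refine Finset.one_le_prod'' fun j => ?_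
      rw [ENNReal.one_le_ofReal]
      exact one_le_pow₀ (Real.one_le_rpow one_le_two (by positivity))
    calc torusMeasure n (box η fun j => 2 ^ k j * h)
        ≤ ∏ j, ENNReal.ofReal (2 * (2 ^ k j * h)) := torusMeasure_box_le _ _
      _ = 2 ^ n * 1 * ∏ j, ENNReal.ofReal (2 ^ k j * h) := by
        simp [ENNReal.ofReal_mul, Finset.prod_mul_distrib]
      _ ≤ _ := by gcongr
  simpa using H (fun _ => 1) (2 ^ n) aemeasurable_const η hη h h0 h1

/-! ### Size of the kernel on restricted Stolz cones -/

theorem norm_lt_one_of_mem_stolz {A : ℝ} {ζ : Circle} {z : ℂ} (hz : z ∈ stolz A ζ) : ‖z‖ < 1 := by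
  obtain ⟨r, θ, h0, h1, -, rfl⟩ := hz
  have e : -((θ : ℂ) * Complex.I) = ((-θ : ℝ) : ℂ) * Complex.I := by push_cast; ring
  rw [e, norm_mul, norm_mul, Complex.norm_exp_ofReal_mul_I, Circle.norm_coe, Complex.norm_real,
    Real.norm_of_nonneg h0]
  linarith

theorem norm_sub_le_of_mem_stolz {A : ℝ} {ζ : Circle} {z : ℂ} (hz : z ∈ stolz A ζ) :
    ‖z - ζ‖ ≤ (1 + A) * (1 - ‖z‖) := by
  obtain ⟨r, θ, h0, h1, hθ, rfl⟩ := hz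
  have e : -((θ : ℂ) * Complex.I) = Complex.I * ((-θ : ℝ) : ℂ) := by push_cast; ring
  set E := Complex.exp (-((θ : ℂ) * Complex.I)) with hE
  have hEn : ‖E‖ = 1 := by rw [hE, e, mul_comm, Complex.norm_exp_ofReal_mul_I]
  have hE1 : ‖E - 1‖ ≤ |θ| := by
    have := Real.norm_exp_I_mul_ofReal_sub_one_le (x := -θ)
    rwa [← e, Real.norm_eq_abs, abs_neg] at this
  have hn : ‖(r : ℂ) * (ζ * E)‖ = r := by
    rw [norm_mul, norm_mul, hEn, Circle.norm_coe, Complex.norm_real, Real.norm_of_nonneg h0]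
    ring
  rw [hn]
  have e2 : (r : ℂ) * (ζ * E) - ζ = ζ * (((r - 1 : ℝ) : ℂ) * E + (E - 1)) := by push_cast; ring
  rw [e2, norm_mul, Circle.norm_coe, one_mul]
  refine (norm_add_le _ _).trans ?_
  rw [norm_mul, hEn, mul_one, Complex.norm_real, Real.norm_eq_abs, abs_of_neg (by linarith)]
  linarith

theorem norm_one_sub_mul_conj (z : ℂ) (ζ : Circle) :
    ‖1 - z * starRingEnd ℂ (ζ : ℂ)‖ = ‖(ζ : ℂ) - z‖ := by
  have h : (1 - z * starRingEnd ℂ (ζ : ℂ)) * ζ = ζ - z := by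
    rw [← Circle.coe_inv_eq_conj, Circle.coe_inv]
    field_simp [Circle.coe_ne_zero ζ]
  rw [← h, norm_mul, Circle.norm_coe, mul_one]

theorem norm_one_sub_conj_mul (z : ℂ) (ζ : Circle) :
    ‖1 - starRingEnd ℂ z * (ζ : ℂ)‖ = ‖(ζ : ℂ) - z‖ := by
  rw [← norm_one_sub_mul_conj, ← Complex.norm_conj]
  simp

/-- The argument is bounded by `π`, so the imaginary part of an exponent costs only a constant. -/
theorem inv_norm_cpow_le (u w : ℂ) (hu : u ≠ 0) :
    ‖u ^ w‖⁻¹ ≤ Real.exp (Real.pi * |w.im|) * (‖u‖ ^ w.re)⁻¹ := by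
  rw [Complex.norm_cpow_of_ne_zero hu, inv_div, div_eq_mul_inv]
  refine mul_le_mul_of_nonneg_right (Real.exp_le_exp.2 ?_) (by positivity)
  calc u.arg * w.im ≤ |u.arg * w.im| := le_abs_self _
    _ = |u.arg| * |w.im| := abs_mul _ _
    _ ≤ _ := by gcongr; exact Complex.abs_arg_le_pi u

/-- Both bases have modulus `|ζ - z|`, so the real exponents add up to `σ + 1`. Since `1 - |z| ≤ |ζ
- z|`, `σ` may be lowered to `s`, which allows one exponent for all coordinates. -/
theorem exists_norm_kernelFactor_le (a b : ℂ) {s : ℝ} (hs : s ≤ a.re + b.re + 1) (hs0 : 0 < s) :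
    ∃ C : ℝ, 0 ≤ C ∧ ∀ (z : ℂ) (ζ : Circle), ‖z‖ < 1 →
      ‖kernelFactor a b z ζ‖ ≤ C * ((1 - ‖z‖) ^ s / ‖(ζ : ℂ) - z‖ ^ (s + 1)) := by
  set σ := a.re + b.re + 1 with hσ
  set C := ‖poissonConst a b‖ * (2 ^ σ * (Real.exp (Real.pi * |(a + 1).im|) *
    Real.exp (Real.pi * |(b + 1).im|))) with hC
  refine ⟨C, by positivity, fun z ζ hz => ?_⟩
  set d := ‖(ζ : ℂ) - z‖ with hd
  set δ := 1 - ‖z‖ with hδ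
  have hδ0 : 0 < δ := by linarith
  have hδd : δ ≤ d := by
    have := norm_sub_norm_le (ζ : ℂ) z
    rwa [Circle.norm_coe] at this
  have hd0 : 0 < d := hδ0.trans_le hδd
  have hu : 1 - z * starRingEnd ℂ (ζ : ℂ) ≠ 0 := by
    rw [← norm_pos_iff, norm_one_sub_mul_conj]; exact hd0
  have hv : 1 - starRingEnd ℂ z * (ζ : ℂ) ≠ 0 := by
    rw [← norm_pos_iff, norm_one_sub_conj_mul]; exact hd0
  have h1 := inv_norm_cpow_le _ (a + 1) hu
  have h2 := inv_norm_cpow_le _ (b + 1) hv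
  rw [norm_one_sub_mul_conj] at h1
  rw [norm_one_sub_conj_mul] at h2
  have hz2 : ‖z‖ ^ 2 < 1 := pow_lt_one₀ (norm_nonneg _) hz two_ne_zero
  have h3 : ‖((1 - ‖z‖ ^ 2 : ℝ) : ℂ) ^ (a + b + 1)‖ ≤ 2 ^ σ * δ ^ σ := by
    rw [cpow_ofReal_one_sub_norm _ hz2, ← Real.mul_rpow two_pos.le hδ0.le]
    have : (a + b + 1).re = σ := by simp [hσ]
    rw [this]
    refine Real.rpow_le_rpow (by linarith) ?_ (by linarith)
    rw [hδ]; nlinarith [norm_nonneg z]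
  have h4 : (d ^ (a + 1).re)⁻¹ * (d ^ (b + 1).re)⁻¹ = (d ^ (σ + 1))⁻¹ := by
    rw [← mul_inv, ← Real.rpow_add hd0]
    congr 2
    simp [hσ]; ring
  have h5 : δ ^ σ * (d ^ (σ + 1))⁻¹ ≤ δ ^ s / d ^ (s + 1) := by
    have e (x : ℝ) : δ ^ x / d ^ (x + 1) = (δ / d) ^ x / d := by
      rw [Real.div_rpow hδ0.le hd0.le, Real.rpow_add_one hd0.ne', div_div]
    rw [← div_eq_mul_inv, e, e]
    gcongr ?_ / d
    exact Real.rpow_le_rpow_of_exponent_ge (by positivity) ((div_le_one hd0).2 hδd) hs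
  calc ‖kernelFactor a b z ζ‖ = ‖poissonConst a b‖ * (‖((1 - ‖z‖ ^ 2 : ℝ) : ℂ) ^ (a + b + 1)‖ *
        (‖(1 - z * starRingEnd ℂ (ζ : ℂ)) ^ (a + 1)‖⁻¹ *
          ‖(1 - starRingEnd ℂ z * (ζ : ℂ)) ^ (b + 1)‖⁻¹)) := by
        rw [kernelFactor, norm_mul, norm_div, norm_mul, div_eq_mul_inv, mul_inv]
    _ ≤ ‖poissonConst a b‖ * ((2 ^ σ * δ ^ σ) *
        ((Real.exp (Real.pi * |(a + 1).im|) * (d ^ (a + 1).re)⁻¹) *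
          (Real.exp (Real.pi * |(b + 1).im|) * (d ^ (b + 1).re)⁻¹))) := by gcongr
    _ = C * (δ ^ σ * ((d ^ (a + 1).re)⁻¹ * (d ^ (b + 1).re)⁻¹)) := by rw [hC]; ring
    _ ≤ _ := by rw [h4]; gcongr

theorem one_sub_norm_le_mul {n : ℕ} {A B : ℝ} {η : Fin n → Circle} {z : Fin n → ℂ}
    (hz : z ∈ restrictedStolz A B η) (j k : Fin n) : 1 - ‖z j‖ ≤ B * (1 - ‖z k‖) := by
  have hk := norm_lt_one_of_mem_stolz (hz.1 k)
  have h := hz.2 j k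
  rwa [div_le_iff₀ (by linarith)] at h

theorem exists_norm_abPoissonKernel_le {n : ℕ} (α β : Fin n → ℂ) {s : ℝ} (hs0 : 0 < s)
    (hs : ∀ j, s ≤ (α j).re + (β j).re + 1) {A B : ℝ} (hA : 0 < A) (hB : 1 ≤ B) :
    ∃ C : ℝ, 0 ≤ C ∧ ∀ (η : Fin n → Circle), ∀ z ∈ restrictedStolz A B η, ∀ (i : Fin n)
      (ζ : Fin n → Circle),
      ‖abPoissonKernel α β z ζ‖ ≤ C * majorant s (1 - ‖z i‖) η ζ := by
  choose C hC0 hC using fun j => exists_norm_kernelFactor_le (α j) (β j) (hs j) hs0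
  -- With `δ ≤ d`: `h ≤ B δ ≤ B d` and `dist (ζ j) (η j) ≤ d + (1 + A) δ ≤ (2 + A) d`.
  set D : ℝ := B + 1 + A + 1 with hD
  have hD0 : 0 < D := by linarith
  refine ⟨∏ j, C j * (B ^ s * D ^ (s + 1)), Finset.prod_nonneg fun j _ =>
    mul_nonneg (hC0 j) (by positivity), fun η z hz i ζ => ?_⟩
  rw [abPoissonKernel_eq_prod, norm_prod, majorant, ← Finset.prod_mul_distrib]
  refine Finset.prod_le_prod (fun j _ => norm_nonneg _) fun j _ => ?_
  have hzj := norm_lt_one_of_mem_stolz (hz.1 j)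
  have hzi := norm_lt_one_of_mem_stolz (hz.1 i)
  refine (hC j (z j) (ζ j) hzj).trans ?_
  rw [mul_assoc]
  refine mul_le_mul_of_nonneg_left ?_ (hC0 j)
  set δ := 1 - ‖z j‖ with hδ
  set h := 1 - ‖z i‖ with hh
  have hδ0 : 0 < δ := by linarith
  have hh0 : 0 < h := by linarith
  have h1 : δ ≤ B * h := one_sub_norm_le_mul hz j i
  have h2 : h ≤ B * δ := one_sub_norm_le_mul hz i j
  set d := ‖((ζ j : Circle) : ℂ) - z j‖
  have hδd : δ ≤ d := by
    have := norm_sub_norm_le ((ζ j : Circle) : ℂ) (z j)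
    rwa [Circle.norm_coe] at this
  have hd0 : 0 < d := hδ0.trans_le hδd
  have ht : dist (ζ j) (η j) ≤ d + (1 + A) * δ := by
    rw [dist_circle]
    calc ‖((ζ j : Circle) : ℂ) - η j‖ = ‖((ζ j : ℂ) - z j) + (z j - η j)‖ := by congr 1; ring
      _ ≤ d + ‖z j - η j‖ := norm_add_le _ _
      _ ≤ _ := by gcongr; exact norm_sub_le_of_mem_stolz (hz.1 j)
  have hlow : h + dist (ζ j) (η j) ≤ D * d := by
    have : (B + 1 + A) * δ ≤ (B + 1 + A) * d := by gcongr
    rw [hD]; linarith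
  have hpos : 0 < h + dist (ζ j) (η j) := by positivity
  have hBh : δ ^ s ≤ B ^ s * h ^ s := by
    rw [← Real.mul_rpow (by linarith) hh0.le]
    exact Real.rpow_le_rpow hδ0.le h1 hs0.le
  have hDd : (h + dist (ζ j) (η j)) ^ (s + 1) ≤ D ^ (s + 1) * d ^ (s + 1) := by
    rw [← Real.mul_rpow hD0.le hd0.le]
    exact Real.rpow_le_rpow hpos.le hlow (by linarith)
  have hp1 : 0 < (h + dist (ζ j) (η j)) ^ (s + 1) := by positivity
  have hp2 : 0 < d ^ (s + 1) := by positivity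
  rw [mul_div_assoc', div_le_div_iff₀ hp2 hp1]
  calc δ ^ s * (h + dist (ζ j) (η j)) ^ (s + 1)
      ≤ (B ^ s * h ^ s) * (D ^ (s + 1) * d ^ (s + 1)) := by gcongr
    _ = _ := by ring

theorem continuous_abPoissonKernel {n : ℕ} (α β z : Fin n → ℂ) (hz : ∀ j, ‖z j‖ < 1) :
    Continuous (abPoissonKernel α β z) :=
  continuous_finsetProd _ fun j _ =>
    (continuous_kernelFactor (α j) (β j) (z j) (hz j)).comp (continuous_apply j)

theorem integrable_abPoissonKernel_mul {n : ℕ} (α β z : Fin n → ℂ) (hz : ∀ j, ‖z j‖ < 1)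
    {f : (Fin n → Circle) → ℂ} (hf : Integrable f (torusMeasure n)) :
    Integrable (fun ζ => abPoissonKernel α β z ζ * f ζ) (torusMeasure n) := by
  have hc := continuous_abPoissonKernel α β z hz
  obtain ⟨C, hC⟩ := isCompact_univ.exists_bound_of_continuousOn hc.continuousOn
  exact hf.bdd_mul hc.aestronglyMeasurable (ae_of_all _ fun ζ => hC ζ trivial)

theorem integral_abPoissonKernel {n : ℕ} (α β z : Fin n → ℂ) :
    ∫ ζ, abPoissonKernel α β z ζ ∂(torusMeasure n) =
      ∏ j, ∫ ζ, kernelFactor (α j) (β j) (z j) ζ ∂circleMeasure :=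
  integral_fintype_prod_eq_prod (𝕜 := ℂ) fun j ζ => kernelFactor (α j) (β j) (z j) ζ

/-! ### Convergence for continuous functions -/

theorem continuous_majorant {n : ℕ} {s h : ℝ} (hh : 0 < h) (η : Fin n → Circle) :
    Continuous (majorant s h η) := by
  refine continuous_finsetProd _ fun j _ => ?_
  have hc : Continuous fun ζ : Fin n → Circle => h + dist (ζ j) (η j) := by fun_prop
  have hpos (ζ : Fin n → Circle) : 0 < h + dist (ζ j) (η j) := by positivity
  exact continuous_const.div (hc.rpow_const fun ζ => Or.inl (hpos ζ).ne')
    fun ζ => (Real.rpow_pos_of_pos (hpos ζ) _).ne'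

theorem integrable_majorant {n : ℕ} {s h : ℝ} (hh : 0 < h) (η : Fin n → Circle) :
    Integrable (majorant s h η) (torusMeasure n) :=
  (continuous_majorant hh η).integrable_of_hasCompactSupport (HasCompactSupport.of_compactSpace _)

theorem exists_integral_majorant_le (n : ℕ) {s : ℝ} (hs : 0 < s) :
    ∃ C : ℝ, 0 ≤ C ∧ ∀ (η : Fin n → Circle) (h : ℝ), 0 < h → h ≤ 1 →
      ∫ ζ, majorant s h η ζ ∂(torusMeasure n) ≤ C := by
  obtain ⟨C, hC, H⟩ := exists_lintegral_majorant_le_const n hs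
  refine ⟨C.toReal, ENNReal.toReal_nonneg, fun η h h0 h1 => ?_⟩
  rw [integral_eq_lintegral_of_nonneg_ae (ae_of_all _ fun ζ => majorant_nonneg s h0 η ζ)
    (continuous_majorant h0 η).aestronglyMeasurable]
  exact ENNReal.toReal_mono hC (H η h h0 h1)

/-- Half of the decay is given up: the quotient of the two majorants is `∏ (h / (h + dist))^(s/2)`,
with all factors at most `1` and the `i`-th one small. What remains still has bounded integrals. -/
theorem majorant_le_mul_majorant_half {n : ℕ} {s h δ : ℝ} (hs : 0 < s) (hh : 0 < h) (hδ : 0 < δ)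
    (η ζ : Fin n → Circle) {i : Fin n} (hi : δ ≤ dist (ζ i) (η i)) :
    majorant s h η ζ ≤ (h / δ) ^ (s / 2) * majorant (s / 2) h η ζ := by
  set ρ : Fin n → ℝ := fun j => (h / (h + dist (ζ j) (η j))) ^ (s / 2)
  have hρ0 (j : Fin n) : 0 ≤ ρ j := by positivity
  have hρ1 (j : Fin n) : ρ j ≤ 1 := by
    refine Real.rpow_le_one (by positivity) ?_ (by positivity)
    rw [div_le_one (by positivity)]
    linarith [dist_nonneg (x := ζ j) (y := η j)]
  have hρi : ρ i ≤ (h / δ) ^ (s / 2) := by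
    refine Real.rpow_le_rpow (by positivity) ?_ (by positivity)
    gcongr
    linarith
  have e : majorant s h η ζ = (∏ j, ρ j) * majorant (s / 2) h η ζ := by
    rw [majorant, majorant, ← Finset.prod_mul_distrib]
    refine Finset.prod_congr rfl fun j _ => ?_
    have hp : 0 < h + dist (ζ j) (η j) := by positivity
    have e1 : s + 1 = s / 2 + (s / 2 + 1) := by ring
    have e2 : h ^ s = h ^ (s / 2) * h ^ (s / 2) := by rw [← Real.rpow_add hh, add_halves]
    rw [e1, Real.rpow_add hp, e2]
    simp only [ρ, Real.div_rpow hh.le hp.le]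
    rw [div_mul_div_comm]
  rw [e]
  refine mul_le_mul_of_nonneg_right ?_ (majorant_nonneg _ hh η ζ)
  rw [← Finset.mul_prod_erase _ _ (Finset.mem_univ i)]
  calc ρ i * ∏ j ∈ Finset.univ.erase i, ρ j ≤ ρ i * 1 := by
        gcongr
        exact Finset.prod_le_one (fun j _ => hρ0 j) fun j _ => hρ1 j
    _ ≤ _ := by rwa [mul_one]

theorem tendsto_norm_apply {n : ℕ} (S : Set (Fin n → ℂ)) (η : Fin n → Circle) (j : Fin n) :
    Tendsto (fun z : Fin n → ℂ => ‖z j‖) (𝓝[S] (torusPoint η)) (𝓝 1) := by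
  have h : Continuous fun z : Fin n → ℂ => ‖z j‖ := by fun_prop
  have h2 := h.tendsto (torusPoint η)
  rw [show ‖torusPoint η j‖ = 1 from Circle.norm_coe _] at h2
  exact h2.mono_left nhdsWithin_le_nhds

theorem eventually_norm_lt_one {n : ℕ} (A B : ℝ) (η : Fin n → Circle) :
    ∀ᶠ z in 𝓝[restrictedStolz A B η] (torusPoint η), ∀ j, ‖z j‖ < 1 := by
  filter_upwards [self_mem_nhdsWithin] with z hz j
  exact norm_lt_one_of_mem_stolz (hz.1 j)

theorem tendsto_integral_abPoissonKernel {n : ℕ} (α β : Fin n → ℂ)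
    (hre : ∀ j, -1 < (α j).re + (β j).re)
    (hα : ∀ j, ∀ k : ℕ, 1 ≤ k → α j ≠ -(k : ℂ))
    (hβ : ∀ j, ∀ k : ℕ, 1 ≤ k → β j ≠ -(k : ℂ)) (A B : ℝ) (η : Fin n → Circle) :
    Tendsto (fun z => ∫ ζ, abPoissonKernel α β z ζ ∂(torusMeasure n))
      (𝓝[restrictedStolz A B η] (torusPoint η)) (𝓝 1) := by
  simp only [integral_abPoissonKernel]
  rw [← Finset.prod_const_one (s := (Finset.univ : Finset (Fin n))) (M := ℂ)]
  refine tendsto_finsetProd _ fun j _ => ?_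
  exact tendsto_integral_kernelFactor (α j) (β j) (hre j) (hα j) (hβ j)
    ((eventually_norm_lt_one A B η).mono fun z hz => hz j) (tendsto_norm_apply _ η j)

theorem hasRNTLimit_of_continuous {n : ℕ} (i : Fin n) (α β : Fin n → ℂ)
    (hre : ∀ j, -1 < (α j).re + (β j).re)
    (hα : ∀ j, ∀ k : ℕ, 1 ≤ k → α j ≠ -(k : ℂ))
    (hβ : ∀ j, ∀ k : ℕ, 1 ≤ k → β j ≠ -(k : ℂ)) {s : ℝ} (hs0 : 0 < s)
    (hs : ∀ j, s ≤ (α j).re + (β j).re + 1) {g : (Fin n → Circle) → ℂ} (hg : Continuous g)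
    (η : Fin n → Circle) : HasRNTLimit (abPoissonIntegral α β g) η (g η) := by
  intro A B hA hB
  set S := restrictedStolz A B η
  obtain ⟨C, hC0, hC⟩ := exists_norm_abPoissonKernel_le α β hs0 hs hA hB
  obtain ⟨C₁, hC₁0, hC₁⟩ := exists_integral_majorant_le n hs0
  obtain ⟨C₂, hC₂0, hC₂⟩ := exists_integral_majorant_le n (half_pos hs0)
  obtain ⟨M, hM⟩ := isCompact_univ.exists_bound_of_continuousOn hg.continuousOn
  have hM0 : 0 ≤ M := (norm_nonneg _).trans (hM η trivial)
  rw [Metric.tendsto_nhds]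
  intro ε hε
  -- Chosen so that `C * ε₁ * C₁ ≤ ε / 2`; the `+ 1` covers `C * C₁ = 0`.
  set ε₁ := ε / (2 * (C * C₁ + 1)) with hε₁
  have hε₁0 : 0 < ε₁ := by positivity
  obtain ⟨δ, hδ0, hδ⟩ := Metric.continuousAt_iff.1 (hg.continuousAt (x := η)) ε₁ hε₁0
  have hh : Tendsto (fun z : Fin n → ℂ => 1 - ‖z i‖) (𝓝[S] (torusPoint η)) (𝓝 0) := by
    simpa using (tendsto_norm_apply S η i).const_sub 1
  have hpow : Tendsto (fun z : Fin n → ℂ => ((1 - ‖z i‖) / δ) ^ (s / 2)) (𝓝[S] (torusPoint η))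
      (𝓝 0) := by
    have h := (hh.div_const δ).rpow_const (p := s / 2) (Or.inr (by positivity))
    simpa [Real.zero_rpow (half_pos hs0).ne'] using h
  have hK := ((tendsto_integral_abPoissonKernel α β hre hα hβ A B η).sub_const 1).norm
  have herr := (hpow.const_mul (C * (2 * M) * C₂)).add (hK.const_mul ‖g η‖)
  simp only [sub_self, norm_zero, mul_zero, add_zero] at herr
  filter_upwards [herr.eventually_lt_const (half_pos hε), self_mem_nhdsWithin] with z hz hzS
  have hz1 (j : Fin n) : ‖z j‖ < 1 := norm_lt_one_of_mem_stolz (hzS.1 j)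
  set h := 1 - ‖z i‖ with hh'
  have h0 : 0 < h := by linarith [hz1 i]
  have h1 : h ≤ 1 := by linarith [norm_nonneg (z i)]
  have hgint : Integrable g (torusMeasure n) :=
    hg.integrable_of_hasCompactSupport (HasCompactSupport.of_compactSpace _)
  have hint := integrable_abPoissonKernel_mul α β z hz1 hgint
  have hint1 := integrable_abPoissonKernel_mul α β z hz1 (integrable_const (g η))
  -- The mass of the kernel is `1` only in the limit, hence the second term.
  have hsplit : abPoissonIntegral α β g z - g η =
      (∫ ζ, abPoissonKernel α β z ζ * (g ζ - g η) ∂(torusMeasure n)) +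
        g η * ((∫ ζ, abPoissonKernel α β z ζ ∂(torusMeasure n)) - 1) := by
    simp only [mul_sub]
    rw [integral_sub hint hint1, integral_mul_const, abPoissonIntegral]
    ring
  have hpt (ζ : Fin n → Circle) : ‖abPoissonKernel α β z ζ * (g ζ - g η)‖ ≤
      C * ε₁ * majorant s h η ζ + C * (2 * M) * (h / δ) ^ (s / 2) * majorant (s / 2) h η ζ := by
    have hm := majorant_nonneg s h0 η ζ
    have hm2 := majorant_nonneg (s / 2) h0 η ζ
    rw [norm_mul]
    by_cases hζ : dist ζ η < δ
    · have h2 : ‖g ζ - g η‖ ≤ ε₁ := by rw [← dist_eq_norm]; exact (hδ hζ).le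
      calc ‖abPoissonKernel α β z ζ‖ * ‖g ζ - g η‖ ≤ C * majorant s h η ζ * ε₁ := by
            gcongr; exact hC η z hzS i ζ
        _ = C * ε₁ * majorant s h η ζ + 0 := by ring
        _ ≤ _ := by gcongr; positivity
    · obtain ⟨j, hj⟩ : ∃ j, δ ≤ dist (ζ j) (η j) := by
        by_contra! hcon
        exact hζ ((dist_pi_lt_iff hδ0).2 hcon)
      have h2 : ‖g ζ - g η‖ ≤ 2 * M := by
        refine (norm_sub_le _ _).trans ?_
        linarith [hM ζ trivial, hM η trivial]
      calc ‖abPoissonKernel α β z ζ‖ * ‖g ζ - g η‖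
          ≤ C * ((h / δ) ^ (s / 2) * majorant (s / 2) h η ζ) * (2 * M) := by
            gcongr
            exact (hC η z hzS i ζ).trans (mul_le_mul_of_nonneg_left
              (majorant_le_mul_majorant_half hs0 h0 hδ0 η ζ hj) hC0)
        _ = 0 + C * (2 * M) * (h / δ) ^ (s / 2) * majorant (s / 2) h η ζ := by ring
        _ ≤ _ := by gcongr; positivity
  have hmi := (integrable_majorant (s := s) h0 η).const_mul (C * ε₁)
  have hmi2 := (integrable_majorant (s := s / 2) h0 η).const_mul
    (C * (2 * M) * (h / δ) ^ (s / 2))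
  have hfirst : ‖∫ ζ, abPoissonKernel α β z ζ * (g ζ - g η) ∂(torusMeasure n)‖ ≤
      C * ε₁ * C₁ + C * (2 * M) * (h / δ) ^ (s / 2) * C₂ := by
    refine (norm_integral_le_of_norm_le (hmi.add hmi2) (ae_of_all _ hpt)).trans ?_
    simp only [Pi.add_apply]
    rw [integral_add hmi hmi2, integral_const_mul, integral_const_mul]
    gcongr
    · exact hC₁ η h h0 h1
    · exact hC₂ η h h0 h1
  have hεC : C * ε₁ * C₁ ≤ ε / 2 := by
    have e : C * ε₁ * C₁ = ε / 2 * (C * C₁ / (C * C₁ + 1)) := by rw [hε₁]; field_simp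
    rw [e]
    refine mul_le_of_le_one_right (by positivity) ?_
    rw [div_le_one (by positivity)]
    linarith
  rw [dist_eq_norm, hsplit]
  refine (norm_add_le _ _).trans_lt ?_
  rw [norm_mul]
  have e : C * (2 * M) * (h / δ) ^ (s / 2) * C₂ = C * (2 * M) * C₂ * (h / δ) ^ (s / 2) := by ring
  rw [e] at hfirst
  linarith

/-! ### Convergence almost everywhere -/

/-- The exceptional set does not depend on `A` and `B`, which enter only through `C`; hence one null
set serves all cones. -/
theorem exists_enorm_abPoissonIntegral_le {n : ℕ} (i : Fin n) (α β : Fin n → ℂ) {s : ℝ}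
    (hs0 : 0 < s) (hs : ∀ j, s ≤ (α j).re + (β j).re + 1) {A B : ℝ} (hA : 0 < A) (hB : 1 ≤ B) :
    ∃ C : ℝ≥0∞, C ≠ ∞ ∧ ∀ (u : (Fin n → Circle) → ℂ) (lam : ℝ≥0∞),
      AEStronglyMeasurable u (torusMeasure n) → ∀ η ∉ exceptionalSet s (fun ζ => ‖u ζ‖ₑ) lam,
        ∀ z ∈ restrictedStolz A B η, ‖abPoissonIntegral α β u z‖ₑ ≤ C * lam := by
  obtain ⟨C, hC0, hC⟩ := exists_norm_abPoissonKernel_le α β hs0 hs hA hB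
  obtain ⟨C', hC'top, hC'⟩ := exists_lintegral_majorant_le n hs0
  refine ⟨ENNReal.ofReal C * C', ENNReal.mul_ne_top ENNReal.ofReal_ne_top hC'top, ?_⟩
  intro u lam hu η hη z hz
  have hzi : ‖z i‖ < 1 := norm_lt_one_of_mem_stolz (hz.1 i)
  have hzn := norm_nonneg (z i)
  have hC'z := hC' (fun ζ => ‖u ζ‖ₑ) lam hu.enorm η hη (1 - ‖z i‖) (by linarith) (by linarith)
  calc ‖abPoissonIntegral α β u z‖ₑ
      ≤ ∫⁻ ζ, ‖abPoissonKernel α β z ζ * u ζ‖ₑ ∂(torusMeasure n) :=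
        enorm_integral_le_lintegral_enorm _
    _ ≤ ∫⁻ ζ, ENNReal.ofReal C * (ENNReal.ofReal (majorant s (1 - ‖z i‖) η ζ) * ‖u ζ‖ₑ)
          ∂(torusMeasure n) := by
        refine lintegral_mono fun ζ => ?_
        rw [enorm_mul, ← mul_assoc, ← ENNReal.ofReal_mul hC0]
        gcongr
        rw [← ofReal_norm]
        exact ENNReal.ofReal_le_ofReal (hC η z hz i ζ)
    _ = ENNReal.ofReal C * ∫⁻ ζ, ENNReal.ofReal (majorant s (1 - ‖z i‖) η ζ) * ‖u ζ‖ₑ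
          ∂(torusMeasure n) := lintegral_const_mul' _ _ ENNReal.ofReal_ne_top
    _ ≤ ENNReal.ofReal C * (C' * lam) := by gcongr
    _ = _ := by ring

/-- Every integrable function on the torus has continuous approximants `g m` with error at most
`2 ^ (-m)` at almost every point for large `m`, in value and for the maximal functions. -/
theorem exists_continuous_approximants {n : ℕ} {s : ℝ} (hs0 : 0 < s) {f : (Fin n → Circle) → ℂ}
    (hf : Integrable f (torusMeasure n)) :
    ∃ g : ℕ → (Fin n → Circle) → ℂ, (∀ m, Continuous (g m)) ∧
      ∀ᵐ η ∂(torusMeasure n), ∀ᶠ m in atTop,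
        η ∉ exceptionalSet s (fun ζ => ‖f ζ - g m ζ‖ₑ) (2⁻¹ ^ m) ∧
          ‖f η - g m η‖ₑ ≤ 2⁻¹ ^ m := by
  obtain ⟨C, hC, hE⟩ := exists_measure_exceptionalSet_le n hs0
  have hne (m : ℕ) : (2⁻¹ : ℝ≥0∞) ^ m ≠ 0 := by simp
  have hnt (m : ℕ) : (2⁻¹ : ℝ≥0∞) ^ m ≠ ∞ := ENNReal.pow_ne_top (by simp)
  -- The `L¹` error is `4^(-m)`: one factor `2^(-m)` is spent on the level, the other makes the
  -- measures summable.
  choose g hg hgint using fun m : ℕ =>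
    hf.exists_boundedContinuous_lintegral_sub_le (mul_ne_zero (hne m) (hne m))
  refine ⟨fun m => g m, fun m => (g m).continuous, ?_⟩
  set G : ℕ → (Fin n → Circle) → ℝ≥0∞ := fun m ζ => ‖f ζ - g m ζ‖ₑ
  have hGm (m : ℕ) : AEMeasurable (G m) (torusMeasure n) :=
    (hf.sub (hgint m)).aestronglyMeasurable.enorm
  have h1 (m : ℕ) : torusMeasure n (exceptionalSet s (G m) (2⁻¹ ^ m)) ≤ C * 2⁻¹ ^ m := by
    rw [← ENNReal.mul_le_mul_iff_right (hne m) (hnt m)]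
    calc _ ≤ C * ∫⁻ ζ, G m ζ ∂(torusMeasure n) := hE (G m) (2⁻¹ ^ m)
      _ ≤ C * (2⁻¹ ^ m * 2⁻¹ ^ m) := by gcongr; exact hg m
      _ = _ := by ring
  have h2 (m : ℕ) : torusMeasure n {η | 2⁻¹ ^ m ≤ G m η} ≤ 2⁻¹ ^ m := by
    rw [← ENNReal.mul_le_mul_iff_right (hne m) (hnt m)]
    exact (mul_meas_ge_le_lintegral₀ (hGm m) _).trans (hg m)
  have hsum : ∑' m : ℕ, torusMeasure n
      (exceptionalSet s (G m) (2⁻¹ ^ m) ∪ {η | 2⁻¹ ^ m ≤ G m η}) ≠ ∞ := by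
    refine ne_top_of_le_ne_top ?_ (ENNReal.tsum_le_tsum fun m =>
      (measure_union_le _ _).trans (add_le_add (h1 m) (h2 m)))
    rw [ENNReal.tsum_add, ENNReal.tsum_mul_left, ENNReal.tsum_geometric, ENNReal.one_sub_inv_two,
      inv_inv]
    finiteness
  filter_upwards [ae_eventually_notMem hsum] with η hη
  filter_upwards [hη] with m hm
  rw [Set.mem_union, not_or] at hm
  exact ⟨hm.1, (not_le.1 hm.2).le⟩

theorem ae_hasRNTLimit_of_pos {n : ℕ} (i : Fin n) (α β : Fin n → ℂ)
    (hre : ∀ j, -1 < (α j).re + (β j).re)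
    (hα : ∀ j, ∀ k : ℕ, 1 ≤ k → α j ≠ -(k : ℂ))
    (hβ : ∀ j, ∀ k : ℕ, 1 ≤ k → β j ≠ -(k : ℂ))
    {f : (Fin n → Circle) → ℂ} (hf : Integrable f (torusMeasure n)) :
    ∀ᵐ η ∂(torusMeasure n), HasRNTLimit (abPoissonIntegral α β f) η (f η) := by
  have : Nonempty (Fin n) := ⟨i⟩
  -- The smallest exponent serves all coordinates.
  obtain ⟨j₀, hj₀⟩ := Finite.exists_min fun j => (α j).re + (β j).re + 1
  set s := (α j₀).re + (β j₀).re + 1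
  have hs0 : 0 < s := by linarith [hre j₀]
  obtain ⟨g, hg, hae⟩ := exists_continuous_approximants hs0 hf
  filter_upwards [hae] with η hη A B hA hB
  obtain ⟨C, hC, H⟩ := exists_enorm_abPoissonIntegral_le i α β hs0 hj₀ hA hB
  rw [EMetric.tendsto_nhds]
  intro ε hε
  have hlim : Tendsto (fun m : ℕ => (C + 1) * (2⁻¹ : ℝ≥0∞) ^ m) atTop (𝓝 0) := by
    have h := ENNReal.Tendsto.const_mul (a := C + 1)
      (ENNReal.tendsto_pow_atTop_nhds_zero_of_lt_one (ENNReal.inv_lt_one.2 ENNReal.one_lt_two))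
      (Or.inr (by finiteness))
    simpa using h
  obtain ⟨m, ⟨hm1, hm2⟩, hm3⟩ :=
    (hη.and (hlim.eventually_lt_const (ENNReal.half_pos hε.ne'))).exists
  have hcont := EMetric.tendsto_nhds.1
    (hasRNTLimit_of_continuous i α β hre hα hβ hs0 hj₀ (hg m) η A B hA hB) (ε / 2)
    (ENNReal.half_pos hε.ne')
  have hgint : Integrable (g m) (torusMeasure n) :=
    (hg m).integrable_of_hasCompactSupport (HasCompactSupport.of_compactSpace _)
  filter_upwards [hcont, self_mem_nhdsWithin] with z hz hzS
  have hz1 (j : Fin n) : ‖z j‖ < 1 := norm_lt_one_of_mem_stolz (hzS.1 j)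
  have hsub : abPoissonIntegral α β f z - abPoissonIntegral α β (g m) z =
      abPoissonIntegral α β (fun ζ => f ζ - g m ζ) z := by
    rw [abPoissonIntegral, abPoissonIntegral, abPoissonIntegral,
      ← integral_sub (integrable_abPoissonKernel_mul α β z hz1 hf)
        (integrable_abPoissonKernel_mul α β z hz1 hgint)]
    simp only [mul_sub]
  have hd1 : edist (abPoissonIntegral α β f z) (abPoissonIntegral α β (g m) z) ≤
      C * 2⁻¹ ^ m := by
    rw [edist_eq_enorm_sub, hsub]
    exact H _ _ (hf.sub hgint).aestronglyMeasurable η hm1 z hzS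
  have hd3 : edist (g m η) (f η) ≤ 2⁻¹ ^ m := by
    rwa [edist_comm, edist_eq_enorm_sub]
  calc edist (abPoissonIntegral α β f z) (f η)
      ≤ edist (abPoissonIntegral α β f z) (abPoissonIntegral α β (g m) z) +
          edist (abPoissonIntegral α β (g m) z) (g m η) + edist (g m η) (f η) :=
        edist_triangle4 _ _ _ _
    _ ≤ C * 2⁻¹ ^ m + edist (abPoissonIntegral α β (g m) z) (g m η) + 2⁻¹ ^ m := by gcongr
    _ = (C + 1) * 2⁻¹ ^ m + edist (abPoissonIntegral α β (g m) z) (g m η) := by ring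
    _ < ε / 2 + ε / 2 := ENNReal.add_lt_add hm3 hz
    _ = ε := ENNReal.add_halves ε

end Polydisc

end

theorem theorem4p6 (n : ℕ) (α β : Fin n → ℂ)
    (hre : ∀ j, -1 < (α j).re + (β j).re)
    (hα : ∀ j, ∀ k : ℕ, 1 ≤ k → α j ≠ -(k : ℂ))
    (hβ : ∀ j, ∀ k : ℕ, 1 ≤ k → β j ≠ -(k : ℂ))
    (f : (Fin n → Circle) → ℂ) (hf : Integrable f (Polydisc.torusMeasure n)) :
    ∀ᵐ η ∂(Polydisc.torusMeasure n),
      Polydisc.HasRNTLimit (Polydisc.abPoissonIntegral α β f) η (f η) := by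
  -- For `n = 0` there is no coordinate to supply the scale `h`; the torus is a point and the kernel
  -- an empty product.
  rcases Nat.eq_zero_or_pos n with rfl | hn
  · refine ae_of_all _ fun η A B _ _ => ?_
    have h : Polydisc.abPoissonIntegral α β f = fun _ => f η := by
      ext z
      have hζ (ζ : Fin 0 → Circle) : Polydisc.abPoissonKernel α β z ζ * f ζ = f η := by
        rw [Subsingleton.elim ζ η]
        simp [Polydisc.abPoissonKernel]
      simp [Polydisc.abPoissonIntegral, hζ]
    rw [h]
    exact tendsto_const_nhds
  · exact Polydisc.ae_hasRNTLimit_of_pos ⟨0, hn⟩ α β hre hα hβ hf
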